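/- Let $\sigma,\delta\in\{1,-1\}$, let $q_-\in\mathbb R$ with $q_0=|q_-|>0$, and put $\sigma_3=\begin{bmatrix}1&0\\0&-1\end{bmatrix}$, $Q_-=\begin{bmatrix}0&q_-\\ \delta\sigma q_-&0\end{bmatrix}$, $$k(z)=\tfrac12\Big(z+\delta\sigma\tfrac{q_0^2}{z}\Big),\qquad \lambda(z)=\tfrac12\Big(z-\delta\sigma\tfrac{q_0^2}{z}\Big),\qquad \theta(x,t;z)=\lambda(z)\big[x+(4k(z)^2+2\sigma\delta q_0^2)t\big].$$ If $\delta\sigma=1$, let $D_\pm=\{\pm\operatorname{Im}z>0\}$ and $\Sigma=\mathbb R\setminus\{0\}$; if $\delta\sigma=-1$, let $D_\pm=\{\pm(|z|-q_0)\operatorname{Im}z>0\}$ and $\Sigma=(\mathbb R\setminus\{0\})\cup\{|z|=q_0\}$. The contour $\Sigma$ is oriented so that $D_+$ lies to its left. Let $z_1,\dots,z_{N_1}$ be distinct points of $D_+$ with positive real part and let $w_1,\dots,w_{N_2}$ be distinct real numbers with $iw_n\in D_+$ ($N_1,N_2\ge 0$). Let $\eta_1,\dots,\eta_{2N_1+N_2}$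 be the points $z_n$ ($n\le N_1$), $-z_n^*$ ($n\le N_1$), $iw_n$ ($n\le N_2$), put $\widehat\eta_n=\delta\sigma q_0^2/\eta_n$ and let $Z=\{\eta_n\}\cup\{\widehat\eta_n\}$ be the discrete spectrum. Let $\varrho,\tilde\varrho$ be complex-valued functions (reflection coefficients) on $\Sigma$, fix $x,t\in\mathbb R$, and let $$J(z)=e^{i\theta(x,t;z)\sigma_3}\begin{bmatrix}0&-\tilde\varrho(z)\\ \varrho(z)&\varrho(z)\tilde\varrho(z)\end{bmatrix}e^{-i\theta(x,t;z)\sigma_3}.$$ Let the $2\times2$ matrix function $M$, equal to $M^+$ on $D_+$ and to $M^-$ on $D_-$, be a solution of the following Riemann–Hilbert problem: * $M^\pm$ is analytic in $D_\pm\setminus Z$, extends continuously to $(D_\pm\cup\Sigma)\setminus Z$ (the extension is again denoted $M^\pm$), and has at most simple poles at the points of $Z\cap D_\pm$; * $M^-(z)=M^+(z)\,(I-J(z))$ for $z\in\Sigma$; * $M^\pm(z)=I+O(1/z)$ as $z\to\infty$ and $M^\pm(z)=\frac iz\sigma_3Q_-+O(1)$ as $z\to0$, for $z\in D_\pm\cup\Sigma$.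 **Theorem.** For every $z\in\mathbb C\setminus(\Sigma\cup\{0\}\cup Z)$ the integral below converges absolutely and $$M(z)=M_0(z)+\frac1{2\pi i}\int_\Sigma\frac{M^+(\zeta)J(\zeta)}{\zeta-z}\,d\zeta,$$ where $$M_0(z)=I+\frac iz\,\sigma_3Q_-+\sum_{n=1}^{2N_1+N_2}\left[\frac{\operatorname{Res}_{\eta_n}M^+}{z-\eta_n}+\frac{\operatorname{Res}_{\widehat\eta_n}M^-}{z-\widehat\eta_n}\right].$$ -/

import Mathlib

open Filter Topology Asymptotics MeasureTheory

noncomputable section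

namespace NonlocalMKdV

/-- `2 × 2` complex matrices. -/
abbrev Mat : Type := Matrix (Fin 2) (Fin 2) ℂ

/-- The constants of the non-zero boundary condition: signs `σ, δ = ±1`, the real boundary value
`q₋` and its modulus `q₀ = |q₋| > 0` (the other boundary value is `q₊ = δ q₋`). -/
structure Background where
  σ : ℝ
  δ : ℝ
  q₀ : ℝ
  qm : ℝ
  sigma_sign : σ = 1 ∨ σ = -1
  delta_sign : δ = 1 ∨ δ = -1
  q₀_pos : 0 < q₀
  abs_qm : |qm| = q₀

namespace Background

variable (B : Background)

/-- The region `D₊`, on which `Im λ > 0`. -/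
def Dplus : Set ℂ :=
  if B.δ * B.σ = 1 then {z | 0 < z.im} else {z | 0 < (‖z‖ - B.q₀) * z.im}

/-- The region `D₋`, on which `Im λ < 0`. -/
def Dminus : Set ℂ :=
  if B.δ * B.σ = 1 then {z | z.im < 0} else {z | (‖z‖ - B.q₀) * z.im < 0}

/-- The continuous spectrum `Σ`: the punctured real axis, together with the circle `|z| = q₀`
when `δσ = -1`. -/
def Sigma : Set ℂ :=
  if B.δ * B.σ = 1 then {z | z.im = 0 ∧ z ≠ 0} else {z | z.im = 0 ∧ z ≠ 0} ∪ {z | ‖z‖ = B.q₀}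

/-- `k(z) = (z + δσ q₀² / z) / 2`. -/
def k (z : ℂ) : ℂ := (z + B.δ * B.σ * B.q₀ ^ 2 / z) / 2

/-- `λ(z) = (z - δσ q₀² / z) / 2`. -/
def lam (z : ℂ) : ℂ := (z - B.δ * B.σ * B.q₀ ^ 2 / z) / 2

/-- `θ(x, t; z) = λ(z) [x + (4 k(z)² + 2 σδ q₀²) t]`. -/
def θ (x t : ℝ) (z : ℂ) : ℂ :=
  B.lam z * (x + (4 * B.k z ^ 2 + 2 * B.σ * B.δ * B.q₀ ^ 2) * t)

/-- `Q₋`. -/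
def Qm : Mat := !![0, (B.qm : ℂ); (B.δ * B.σ * B.qm : ℂ), 0]

end Background

/-- The Pauli matrix `σ₃`. -/
def σ₃ : Mat := !![1, 0; 0, -1]

/-- The diagonal matrix `e^{a σ₃}`. -/
def expSigma₃ (a : ℂ) : Mat := !![Complex.exp a, 0; 0, Complex.exp (-a)]

/-- The jump matrix `J(x, t; z) = e^{iθσ₃} [[0, -ϱ̃], [ϱ, ϱ ϱ̃]] e^{-iθσ₃}` with reflection
coefficients `ϱ`, `ϱ̃`. -/
def jump (B : Background) (ρ ρt : ℂ → ℂ) (x t : ℝ) (z : ℂ) : Mat :=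
  expSigma₃ (Complex.I * B.θ x t z) * !![0, -ρt z; ρ z, ρ z * ρt z] *
    expSigma₃ (-(Complex.I * B.θ x t z))

/-- The independent part of a discrete spectrum: distinct points `z₁, …` (numbering `N₁`) of `D₊`
in the open right half plane and distinct points `i w₁, …` (numbering `N₂`) of `D₊` on the
imaginary axis. -/
structure DiscreteData (B : Background) where
  N₁ : ℕ
  N₂ : ℕ
  z : Fin N₁ → ℂ
  w : Fin N₂ → ℝ
  z_injective : Function.Injective z
  w_injective : Function.Injective w
  z_mem : ∀ n, z n ∈ B.Dplus
  z_re_pos : ∀ n, 0 < (z n).re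
  w_mem : ∀ n, Complex.I * w n ∈ B.Dplus

namespace DiscreteData

variable {B : Background} (S : DiscreteData B)

/-- The set of the `2 N₁ + N₂` indices of the points `η`. -/
abbrev Index : Type := (Fin S.N₁ ⊕ Fin S.N₁) ⊕ Fin S.N₂

/-- The points `η`: first the `z_n`, then the `-z_n*`, then the `i w_n`. -/
def η : S.Index → ℂ :=
  Sum.elim (Sum.elim S.z fun n => -(starRingEnd ℂ) (S.z n)) fun n => Complex.I * S.w n

/-- The reflected points `η̂_n = δσ q₀² / η_n`. -/
def ηhat (n : S.Index) : ℂ := B.δ * B.σ * B.q₀ ^ 2 / S.η n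

/-- The discrete spectrum
`Z = {z_n, -z_n*, δσ q₀²/z_n, -δσ q₀²/z_n*} ∪ {i w_n, -δσ i q₀²/w_n}`. -/
def Z : Set ℂ := Set.range S.η ∪ Set.range S.ηhat

end DiscreteData

/-- `f` is analytic at `z₀` (up to its value there) or has a simple pole at `z₀`, entry by entry. -/
def HasAtMostSimplePole (f : ℂ → Mat) (z₀ : ℂ) : Prop :=
  ∀ i j, MeromorphicAt (fun z => f z i j) z₀ ∧
    (-1 : WithTop ℤ) ≤ meromorphicOrderAt (fun z => f z i j) z₀

/-- The residue at `z₀` of a matrix function with at most a simple pole there: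
`lim_{z → z₀} (z - z₀) f(z)`. -/
def simpleResidue (f : ℂ → Mat) (z₀ : ℂ) : Mat :=
  limUnder (𝓝[≠] z₀) fun z => (z - z₀) • f z

/-- `(M⁺, M⁻)` solves the Riemann–Hilbert problem. Only the values of `M⁺` on `(D₊ ∪ Σ) \ Z` and
those of `M⁻` on `(D₋ ∪ Σ) \ Z` matter; the values on `Σ` are the boundary values from the two
sides. -/
structure IsRHPSolution (B : Background) (S : DiscreteData B) (ρ ρt : ℂ → ℂ) (x t : ℝ)
    (Mp Mm : ℂ → Mat) : Prop where
  analytic_plus : ∀ i j, AnalyticOnNhd ℂ (fun z => Mp z i j) (B.Dplus \ S.Z)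
  analytic_minus : ∀ i j, AnalyticOnNhd ℂ (fun z => Mm z i j) (B.Dminus \ S.Z)
  continuous_plus : ContinuousOn Mp ((B.Dplus ∪ B.Sigma) \ S.Z)
  continuous_minus : ContinuousOn Mm ((B.Dminus ∪ B.Sigma) \ S.Z)
  pole_plus : ∀ z₀ ∈ S.Z ∩ B.Dplus, HasAtMostSimplePole Mp z₀
  pole_minus : ∀ z₀ ∈ S.Z ∩ B.Dminus, HasAtMostSimplePole Mm z₀
  jump_relation : ∀ z ∈ B.Sigma, Mm z = Mp z * (1 - jump B ρ ρt x t z)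
  infty_plus : ∀ i j, (fun z => (Mp z - 1) i j)
    =O[cocompact ℂ ⊓ 𝓟 (B.Dplus ∪ B.Sigma)] fun z => 1 / z
  infty_minus : ∀ i j, (fun z => (Mm z - 1) i j)
    =O[cocompact ℂ ⊓ 𝓟 (B.Dminus ∪ B.Sigma)] fun z => 1 / z
  zero_plus : ∀ i j, (fun z => (Mp z - (Complex.I / z) • (σ₃ * B.Qm)) i j)
    =O[𝓝[B.Dplus ∪ B.Sigma] 0] fun _ => (1 : ℂ)
  zero_minus : ∀ i j, (fun z => (Mm z - (Complex.I / z) • (σ₃ * B.Qm)) i j)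
    =O[𝓝[B.Dminus ∪ B.Sigma] 0] fun _ => (1 : ℂ)

open Classical in
/-- The sectionally meromorphic matrix `M`: `M⁺` on `D₊` and `M⁻` on `D₋`. -/
def sectional (B : Background) (Mp Mm : ℂ → Mat) (z : ℂ) : Mat :=
  if z ∈ B.Dplus then Mp z else Mm z

/-- Absolute integrability of `g` along `Σ`. -/
def ContourIntegrable (B : Background) (g : ℂ → ℂ) : Prop :=
  Integrable (fun s : ℝ => g s) ∧ (B.δ * B.σ = -1 → CircleIntegrable g 0 B.q₀)

/-- `∫_Σ g(ζ) dζ` along `Σ`, oriented so that `D₊` lies to the left.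
For `δσ = 1` this is the real axis from left to right. For `δσ = -1` the half-lines `|s| > q₀` are
traversed from left to right, the segment from `q₀` to `-q₀`, and both half circles (the upper one
clockwise, the lower one counterclockwise) from `-q₀` to `q₀`. -/
def contourIntegral (B : Background) (g : ℂ → ℂ) : ℂ :=
  if B.δ * B.σ = 1 then ∫ s : ℝ, g s
  else
    (∫ s in {s : ℝ | B.q₀ < |s|}, g s) - (∫ s in (-B.q₀)..B.q₀, g s)
      + (∫ φ in Real.pi..0, deriv (circleMap 0 B.q₀) φ * g (circleMap 0 B.q₀ φ))
      + ∫ φ in Real.pi..(2 * Real.pi), deriv (circleMap 0 B.q₀) φ * g (circleMap 0 B.q₀ φ)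

/-- `M₀(z) = I + (i/z) σ₃ Q₋ + ∑_n [Res_{η_n} M⁺ / (z - η_n) + Res_{η̂_n} M⁻ / (z - η̂_n)]`. -/
def M₀ (B : Background) (S : DiscreteData B) (Mp Mm : ℂ → Mat) (z : ℂ) : Mat :=
  1 + (Complex.I / z) • (σ₃ * B.Qm)
    + ∑ n : S.Index, ((1 / (z - S.η n)) • simpleResidue Mp (S.η n)
        + (1 / (z - S.ηhat n)) • simpleResidue Mm (S.ηhat n))

end NonlocalMKdV

end

noncomputable section

namespace NonlocalMKdV

/-! The argument is scalar: fix an entry and a point `z`. Let `R` be that entry of `M₀`, a rational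
function whose poles are `0` and the points of `Z`, and let `c` be the entry of `M(z) - M₀(z)`. On
each side put `F^± = (M^± - R - c) / (ζ - z)`. Subtracting `R` removes the poles of `M^±` in `D_±`;
subtracting `c` makes the numerator vanish at `z`, on the side containing `z`. So `F^±` extends
holomorphically to `D_±` and continuously to `Σ` (`exists_cauchyQuotient`). Since `R` and `c` are
the same on both sides, they drop out of the jump: on `Σ`, `F^+ - F^- = (M^+ - M^-) / (ζ - z) = M^+
J / (ζ - z)`.

At the origin the singular parts of `M^±` and `R` agree, so `ζ F^±(ζ) → 0`. At infinity both tend to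
the same constant, so `ζ F^±(ζ) → -c`. Cauchy's theorem then reduces the integral of `F^+ - F^-`
over `Σ` to the arcs at infinity, and its value is `2πi c` (`contourIntegral_sub_eq`). This is the
claim, and no residue theorem is needed.

Each `F^±` alone need not be integrable along the real axis near `0` or infinity; only the
difference is (`integrable_jump_quotient`). Hence Cauchy's theorem is applied on half annuli,
truncated at the same radius on both half-lines, and the limit is taken after subtracting. -/

/-! ### Cauchy's theorem on half annuli and limits of arc integrals. -/

open Complex in
/-- Cauchy's theorem for the boundary of the annular sector `a ≤ r ≤ b`, `α ≤ φ ≤ β`. -/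
theorem integral_annular_sector_eq_zero {F : ℂ → ℂ} {a b α β : ℝ} (ha : 0 < a) (hab : a ≤ b)
    (hαβ : α ≤ β) {A : Set ℂ} (hc : ContinuousOn F A)
    (hA : ∀ r ∈ Set.Icc a b, ∀ φ ∈ Set.Icc α β, circleMap 0 r φ ∈ A)
    (hd : ∀ r ∈ Set.Ioo a b, ∀ φ ∈ Set.Ioo α β, DifferentiableAt ℂ F (circleMap 0 r φ)) :
    exp (α * I) * (∫ r in a..b, F (circleMap 0 r α))
      - exp (β * I) * (∫ r in a..b, F (circleMap 0 r β))
      + (∫ φ in α..β, deriv (circleMap 0 b) φ * F (circleMap 0 b φ))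
      - (∫ φ in α..β, deriv (circleMap 0 a) φ * F (circleMap 0 a φ)) = 0 := by
  have hb : 0 < b := ha.trans_le hab
  have hlog : Real.log a ≤ Real.log b := Real.log_le_log ha hab
  have hexp : ∀ u φ : ℝ, exp (u + φ * I) = circleMap 0 (Real.exp u) φ := by
    intro u φ
    simp [circleMap, exp_add]
  have hexp' : ∀ w : ℂ, exp w = circleMap 0 (Real.exp w.re) w.im := by
    intro w
    rw [← hexp, re_add_im]
  -- The exponential maps the rectangle `[log a, log b] × [α, β]` onto the sector, and `F(e^w) e^w
  -- dw` is the pullback of `F(ζ) dζ`.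
  have key := integral_boundary_rect_eq_zero_of_differentiable_on_off_countable
    (fun w => F (exp w) * exp w) (Real.log a + α * I) (Real.log b + β * I) ∅
    Set.countable_empty ?_ ?_
  · have hray : ∀ γ ∈ Set.Icc α β,
        (∫ u in Real.log a..Real.log b, F (exp (u + γ * I)) * exp (u + γ * I))
          = exp (γ * I) * ∫ r in a..b, F (circleMap 0 r γ) := by
      intro γ hγ
      have hsub := intervalIntegral.integral_deriv_smul_comp'' (a := Real.log a) (b := Real.log b)
        (f := Real.exp) (f' := Real.exp) (g := fun r : ℝ => F (circleMap 0 r γ))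
        Real.continuous_exp.continuousOn
        (fun x _ => (Real.hasDerivAt_exp x).hasDerivWithinAt) Real.continuous_exp.continuousOn
        (by
          refine hc.comp (by unfold circleMap; fun_prop) ?_
          rintro _ ⟨u, hu, rfl⟩
          rw [Set.uIcc_of_le hlog] at hu
          exact hA _ ⟨(Real.log_le_iff_le_exp ha).1 hu.1, (Real.le_log_iff_exp_le hb).1 hu.2⟩ _ hγ)
      rw [Real.exp_log ha, Real.exp_log hb] at hsub
      rw [← hsub, ← intervalIntegral.integral_const_mul]
      refine intervalIntegral.integral_congr fun u _ => ?_
      simp only [Function.comp_apply, hexp, real_smul]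
      simp only [circleMap, zero_add]
      push_cast
      ring
    have harc : ∀ c : ℝ, 0 < c →
        I • (∫ y in α..β, F (exp (Real.log c + y * I)) * exp (Real.log c + y * I))
          = ∫ φ in α..β, deriv (circleMap 0 c) φ * F (circleMap 0 c φ) := by
      intro c hc'
      rw [smul_eq_mul, ← intervalIntegral.integral_const_mul]
      refine intervalIntegral.integral_congr fun y _ => ?_
      simp only [hexp, Real.exp_log hc', deriv_circleMap]
      ring
    rw [← hray α ⟨le_rfl, hαβ⟩, ← hray β ⟨hαβ, le_rfl⟩, ← harc a ha, ← harc b hb]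
    simpa using key
  · refine ContinuousOn.mul (hc.comp continuous_exp.continuousOn ?_) continuous_exp.continuousOn
    intro w hw
    rw [mem_reProdIm] at hw
    simp only [add_re, ofReal_re, mul_re, I_re, mul_zero, ofReal_im, I_im, mul_one, sub_self,
      add_zero, add_im, mul_im, zero_add, Set.uIcc_of_le hlog, Set.uIcc_of_le hαβ] at hw
    rw [hexp']
    exact hA _ ⟨(Real.log_le_iff_le_exp ha).1 hw.1.1, (Real.le_log_iff_exp_le hb).1 hw.1.2⟩ _ hw.2
  · rintro w ⟨hw, -⟩
    rw [mem_reProdIm] at hw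
    simp only [add_re, ofReal_re, mul_re, I_re, mul_zero, ofReal_im, I_im, mul_one, sub_self,
      add_zero, add_im, mul_im, zero_add, min_eq_left hlog, max_eq_right hlog, min_eq_left hαβ,
      max_eq_right hαβ] at hw
    have h := hd _ ⟨(Real.log_lt_iff_lt_exp ha).1 hw.1.1, (Real.lt_log_iff_exp_lt hb).1 hw.1.2⟩
      _ hw.2
    rw [← hexp'] at h
    exact (h.comp w differentiable_exp.differentiableAt).mul differentiable_exp.differentiableAt

theorem norm_circleMap_zero_of_pos {r : ℝ} (hr : 0 < r) (φ : ℝ) : ‖circleMap 0 r φ‖ = r := by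
  simp [abs_of_pos hr]

theorem circleMap_zero_im (r φ : ℝ) : (circleMap 0 r φ).im = r * Real.sin φ := by
  simp [circleMap, Complex.exp_ofReal_mul_I_im]

theorem circleMap_zero_zero (r : ℝ) : circleMap 0 r 0 = r := by simp [circleMap]

theorem circleMap_zero_pi (r : ℝ) : circleMap 0 r Real.pi = ((-r : ℝ) : ℂ) := by simp [circleMap]

theorem circleMap_zero_two_pi (r : ℝ) : circleMap 0 r (2 * Real.pi) = r := by simp [circleMap]

theorem sin_nonpos_of_mem_Icc {φ : ℝ} (h : φ ∈ Set.Icc Real.pi (2 * Real.pi)) :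
    Real.sin φ ≤ 0 := by
  have := Real.sin_nonneg_of_nonneg_of_le_pi (x := φ - Real.pi) (by linarith [h.1])
    (by linarith [h.2])
  rw [Real.sin_sub_pi] at this
  linarith

theorem sin_neg_of_mem_Ioo {φ : ℝ} (h : φ ∈ Set.Ioo Real.pi (2 * Real.pi)) : Real.sin φ < 0 := by
  have := Real.sin_pos_of_pos_of_lt_pi (x := φ - Real.pi) (by linarith [h.1])
    (by linarith [h.2])
  rw [Real.sin_sub_pi] at this
  linarith

/-- The integral of `F` along the arc `|ζ| = r`, `α ≤ arg ζ ≤ β`. -/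
def arcIntegral (F : ℂ → ℂ) (α β r : ℝ) : ℂ :=
  ∫ φ in α..β, deriv (circleMap 0 r) φ * F (circleMap 0 r φ)

/-- The sum of the integrals of `F` along `[a, b]` and `[-b, -a]`. -/
def symmIntegral (F : ℂ → ℂ) (a b : ℝ) : ℂ := ∫ s in a..b, (F s + F ((-s : ℝ) : ℂ))

theorem intervalIntegrable_comp_ray {F : ℂ → ℂ} {A : Set ℂ} {a b φ : ℝ} (hab : a ≤ b)
    (hc : ContinuousOn F A) (hA : ∀ r ∈ Set.Icc a b, circleMap 0 r φ ∈ A) :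
    IntervalIntegrable (fun r : ℝ => F (circleMap 0 r φ)) volume a b := by
  refine ContinuousOn.intervalIntegrable (hc.comp (by unfold circleMap; fun_prop) ?_)
  rw [Set.uIcc_of_le hab]
  exact hA

/-- On the ray of angle `π` the factor `e^{iπ} = -1` turns the difference of the two ray integrals
into the sum over `[a, b]` and `[-b, -a]`. -/
theorem symmIntegral_add_arc_upper {F : ℂ → ℂ} {a b : ℝ} (ha : 0 < a) (hab : a ≤ b)
    {A D : Set ℂ} (hc : ContinuousOn F A) (hd : ∀ ζ ∈ D, DifferentiableAt ℂ F ζ)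
    (hA : ∀ ζ : ℂ, a ≤ ‖ζ‖ → ‖ζ‖ ≤ b → 0 ≤ ζ.im → ζ ∈ A)
    (hD : ∀ ζ : ℂ, a < ‖ζ‖ → ‖ζ‖ < b → 0 < ζ.im → ζ ∈ D) :
    symmIntegral F a b + arcIntegral F 0 Real.pi b - arcIntegral F 0 Real.pi a = 0 := by
  have hA' : ∀ r ∈ Set.Icc a b, ∀ φ ∈ Set.Icc 0 Real.pi, circleMap 0 r φ ∈ A := by
    intro r hr φ hφ
    have hr0 : 0 < r := ha.trans_le hr.1
    refine hA _ ?_ ?_ ?_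
    · rw [norm_circleMap_zero_of_pos hr0]; exact hr.1
    · rw [norm_circleMap_zero_of_pos hr0]; exact hr.2
    · rw [circleMap_zero_im]
      exact mul_nonneg hr0.le (Real.sin_nonneg_of_mem_Icc hφ)
  have key := integral_annular_sector_eq_zero ha hab Real.pi_pos.le hc hA' (by
    intro r hr φ hφ
    have hr0 : 0 < r := ha.trans hr.1
    refine hd _ (hD _ ?_ ?_ ?_)
    · rw [norm_circleMap_zero_of_pos hr0]; exact hr.1
    · rw [norm_circleMap_zero_of_pos hr0]; exact hr.2
    · rw [circleMap_zero_im]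
      exact mul_pos hr0 (Real.sin_pos_of_mem_Ioo hφ))
  have h0 := intervalIntegrable_comp_ray hab hc (fun r hr => hA' r hr 0 ⟨le_rfl, Real.pi_pos.le⟩)
  have hπ := intervalIntegrable_comp_ray hab hc (fun r hr => hA' r hr Real.pi ⟨Real.pi_pos.le, le_rfl⟩)
  simp only [circleMap_zero_zero, circleMap_zero_pi] at h0 hπ key
  rw [symmIntegral, intervalIntegral.integral_add h0 hπ, arcIntegral, arcIntegral]
  simp only [Complex.ofReal_zero, zero_mul, Complex.exp_zero, Complex.exp_pi_mul_I] at key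
  linear_combination key

/-- The sector now starts at angle `π` and ends at `2π`, so the real segments are traversed from
right to left; this accounts for the signs opposite to those of the upper half. -/
theorem symmIntegral_sub_arc_lower {F : ℂ → ℂ} {a b : ℝ} (ha : 0 < a) (hab : a ≤ b)
    {A D : Set ℂ} (hc : ContinuousOn F A) (hd : ∀ ζ ∈ D, DifferentiableAt ℂ F ζ)
    (hA : ∀ ζ : ℂ, a ≤ ‖ζ‖ → ‖ζ‖ ≤ b → ζ.im ≤ 0 → ζ ∈ A)
    (hD : ∀ ζ : ℂ, a < ‖ζ‖ → ‖ζ‖ < b → ζ.im < 0 → ζ ∈ D) :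
    symmIntegral F a b - arcIntegral F Real.pi (2 * Real.pi) b
      + arcIntegral F Real.pi (2 * Real.pi) a = 0 := by
  have hπ2 : Real.pi ≤ 2 * Real.pi := by linarith [Real.pi_pos]
  have hA' : ∀ r ∈ Set.Icc a b, ∀ φ ∈ Set.Icc Real.pi (2 * Real.pi), circleMap 0 r φ ∈ A := by
    intro r hr φ hφ
    have hr0 : 0 < r := ha.trans_le hr.1
    refine hA _ ?_ ?_ ?_
    · rw [norm_circleMap_zero_of_pos hr0]; exact hr.1
    · rw [norm_circleMap_zero_of_pos hr0]; exact hr.2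
    · rw [circleMap_zero_im]
      exact mul_nonpos_of_nonneg_of_nonpos hr0.le (sin_nonpos_of_mem_Icc hφ)
  have key := integral_annular_sector_eq_zero ha hab hπ2 hc hA' (by
    intro r hr φ hφ
    have hr0 : 0 < r := ha.trans hr.1
    refine hd _ (hD _ ?_ ?_ ?_)
    · rw [norm_circleMap_zero_of_pos hr0]; exact hr.1
    · rw [norm_circleMap_zero_of_pos hr0]; exact hr.2
    · rw [circleMap_zero_im]
      exact mul_neg_of_pos_of_neg hr0 (sin_neg_of_mem_Ioo hφ))
  have h0 := intervalIntegrable_comp_ray hab hc (fun r hr => hA' r hr (2 * Real.pi) ⟨hπ2, le_rfl⟩)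
  have hπ := intervalIntegrable_comp_ray hab hc (fun r hr => hA' r hr Real.pi ⟨le_rfl, hπ2⟩)
  simp only [circleMap_zero_two_pi, circleMap_zero_pi] at h0 hπ key
  rw [symmIntegral, intervalIntegral.integral_add h0 hπ, arcIntegral, arcIntegral]
  have h2 : Complex.exp (((2 * Real.pi : ℝ) : ℂ) * Complex.I) = 1 := by
    push_cast
    exact Complex.exp_two_pi_mul_I
  simp only [h2, Complex.exp_pi_mul_I] at key
  linear_combination -key

/-- If `ζ F(ζ) → L` uniformly on arcs of radius `r`, then the arc integrals tend to
`i (β - α) L`. -/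
theorem tendsto_arcIntegral {F : ℂ → ℂ} {α β : ℝ} (hαβ : α ≤ β) {A : Set ℂ} {L : ℂ}
    {l : Filter ℝ} {m : Filter ℂ} (hc : ContinuousOn F A)
    (hA : ∀ᶠ r in l, 0 < r ∧ ∀ φ ∈ Set.Icc α β, circleMap 0 r φ ∈ A)
    (hm : ∀ U ∈ m, ∀ᶠ r in l, ∀ φ, circleMap 0 r φ ∈ U)
    (hL : Tendsto (fun ζ => ζ * F ζ) (m ⊓ 𝓟 A) (𝓝 L)) :
    Tendsto (arcIntegral F α β) l (𝓝 (Complex.I * (β - α) * L)) := by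
  rw [Metric.tendsto_nhds]
  intro ε hε
  -- The summand `1` keeps the denominator of `ε / (β - α + 1)` positive when `α = β`.
  have hβα : 0 < β - α + 1 := by linarith
  have h1 := hL.eventually (Metric.ball_mem_nhds L (div_pos hε hβα))
  rw [eventually_inf_principal] at h1
  filter_upwards [hA, hm _ h1] with r hr hr'
  have hci : ContinuousOn (fun φ => deriv (circleMap 0 r) φ * F (circleMap 0 r φ))
      (Set.uIcc α β) := by
    rw [Set.uIcc_of_le hαβ]
    simp only [deriv_circleMap]
    exact ContinuousOn.mul (by fun_prop) (hc.comp (continuous_circleMap 0 r).continuousOn hr.2)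
  have heq : arcIntegral F α β r - Complex.I * (β - α) * L
      = ∫ φ in α..β, (deriv (circleMap 0 r) φ * F (circleMap 0 r φ) - Complex.I * L) := by
    rw [intervalIntegral.integral_sub hci.intervalIntegrable intervalIntegrable_const, arcIntegral,
      intervalIntegral.integral_const, Complex.real_smul]
    push_cast
    ring
  rw [dist_eq_norm, heq]
  have hle : ‖∫ φ in α..β, (deriv (circleMap 0 r) φ * F (circleMap 0 r φ) - Complex.I * L)‖
      ≤ ε / (β - α + 1) * |β - α| := by
    refine intervalIntegral.norm_integral_le_of_norm_le_const fun φ hφ => ?_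
    rw [Set.uIoc_of_le hαβ] at hφ
    have h2 := hr' φ (hr.2 φ ⟨hφ.1.le, hφ.2⟩)
    simp only [dist_eq_norm] at h2
    rw [deriv_circleMap]
    have : circleMap 0 r φ * Complex.I * F (circleMap 0 r φ) - Complex.I * L
        = Complex.I * (circleMap 0 r φ * F (circleMap 0 r φ) - L) := by ring
    rw [this, norm_mul, Complex.norm_I, one_mul]
    exact h2.le
  refine hle.trans_lt ?_
  rw [abs_of_nonneg (by linarith), div_mul_eq_mul_div, div_lt_iff₀ hβα]
  nlinarith

theorem eventually_circleMap_mem_nhds_zero : ∀ U ∈ 𝓝[≠] (0 : ℂ), ∀ᶠ r in 𝓝[>] (0 : ℝ),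
    ∀ φ, circleMap 0 r φ ∈ U := by
  intro U hU
  obtain ⟨ε, hε, hεU⟩ := Metric.mem_nhdsWithin_iff.1 hU
  filter_upwards [Ioo_mem_nhdsGT hε] with r hr φ
  refine hεU ⟨?_, ?_⟩
  · rw [mem_ball_zero_iff, norm_circleMap_zero_of_pos hr.1]
    exact hr.2
  · rw [Set.mem_compl_iff, Set.mem_singleton_iff, ← norm_eq_zero, norm_circleMap_zero_of_pos hr.1]
    exact hr.1.ne'

theorem eventually_circleMap_mem_cocompact : ∀ U ∈ cocompact ℂ, ∀ᶠ r in (atTop : Filter ℝ),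
    ∀ φ, circleMap 0 r φ ∈ U := by
  intro U hU
  rw [← Metric.cobounded_eq_cocompact, ← comap_norm_atTop] at hU
  obtain ⟨V, hV, hVU⟩ := hU
  filter_upwards [hV, eventually_gt_atTop 0] with r hr hr0 φ
  refine hVU ?_
  rwa [Set.mem_preimage, norm_circleMap_zero_of_pos hr0]

/-! ### Symmetric truncations of integrals over the real line. -/

section Real

variable {Φ : ℂ → ℂ}

theorem integrable_add_comp_neg (hΦ : Integrable fun s : ℝ => Φ s) :
    Integrable fun s : ℝ => Φ s + Φ ((-s : ℝ) : ℂ) :=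
  hΦ.add (hΦ.comp_neg (f := fun s : ℝ => Φ s))

theorem tendsto_symmIntegral_atTop (hΦ : Integrable fun s : ℝ => Φ s) {q : ℝ} (hq : 0 ≤ q) :
    Tendsto (symmIntegral Φ q) atTop (𝓝 (∫ s in {s : ℝ | q < |s|}, Φ s)) := by
  have h := intervalIntegral_tendsto_integral_Ioi q (integrable_add_comp_neg hΦ).integrableOn tendsto_id
  have heq : (∫ s in Set.Ioi q, (Φ s + Φ ((-s : ℝ) : ℂ))) = ∫ s in {s : ℝ | q < |s|}, Φ s := by
    rw [integral_add hΦ.integrableOn (hΦ.comp_neg (f := fun s : ℝ => Φ s)).integrableOn,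
      integral_comp_neg_Ioi q (fun s : ℝ => Φ s), integral_Iic_eq_integral_Iio]
    have hset : {s : ℝ | q < |s|} = Set.Ioi q ∪ Set.Iio (-q) := by
      ext s
      simp only [Set.mem_ofPred_eq, lt_abs, Set.mem_union, Set.mem_Ioi, Set.mem_Iio]
      constructor <;> rintro (h | h) <;> first | (left; linarith) | (right; linarith)
    rw [hset, setIntegral_union _ measurableSet_Iio hΦ.integrableOn hΦ.integrableOn]
    rw [Set.disjoint_left]
    intro s hs hs'
    simp only [Set.mem_Ioi, Set.mem_Iio] at hs hs'
    linarith
  rw [← heq]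
  exact h

theorem tendsto_symmIntegral_zero (hΦ : Integrable fun s : ℝ => Φ s) (q : ℝ) :
    Tendsto (fun a => symmIntegral Φ a q) (𝓝[>] 0) (𝓝 (∫ s in (-q)..q, Φ s)) := by
  have hi := integrable_add_comp_neg hΦ
  have h : Continuous fun a => symmIntegral Φ a q := by
    have := (intervalIntegral.continuous_primitive (fun _ _ => hi.intervalIntegrable) q).neg
    refine this.congr fun a => ?_
    rw [symmIntegral, intervalIntegral.integral_symm, Pi.neg_apply]
  have heq : symmIntegral Φ 0 q = ∫ s in (-q)..q, Φ s := by
    rw [symmIntegral, intervalIntegral.integral_add hΦ.intervalIntegrable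
      (hΦ.comp_neg (f := fun s : ℝ => Φ s)).intervalIntegrable,
      intervalIntegral.integral_comp_neg (fun s : ℝ => Φ s), neg_zero, add_comm,
      intervalIntegral.integral_add_adjacent_intervals hΦ.intervalIntegrable
      hΦ.intervalIntegrable]
  rw [← heq]
  exact (h.tendsto 0).mono_left nhdsWithin_le_nhds

end Real

/-! ### Pairs of functions on the upper and lower halves of a disc or its exterior. -/

section HalfPlanes

variable {Fu Fl : ℂ → ℂ} {Au Al Du Dl : Set ℂ} {q : ℝ}

/-- Away from `0` and infinity each function is continuous, so the integral may be split here; over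
the whole line it may not. -/
theorem symmIntegral_sub {a b : ℝ} (ha : 0 < a) (hab : a ≤ b)
    (hu : ContinuousOn Fu Au) (hl : ContinuousOn Fl Al)
    (hAu : ∀ ζ : ℂ, a ≤ ‖ζ‖ → ‖ζ‖ ≤ b → 0 ≤ ζ.im → ζ ∈ Au)
    (hAl : ∀ ζ : ℂ, a ≤ ‖ζ‖ → ‖ζ‖ ≤ b → ζ.im ≤ 0 → ζ ∈ Al) :
    symmIntegral (fun ζ => Fu ζ - Fl ζ) a b = symmIntegral Fu a b - symmIntegral Fl a b := by
  have key : ∀ {F : ℂ → ℂ} {A : Set ℂ}, ContinuousOn F A →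
      (∀ ζ : ℂ, a ≤ ‖ζ‖ → ‖ζ‖ ≤ b → ζ.im = 0 → ζ ∈ A) →
      IntervalIntegrable (fun s : ℝ => F s + F ((-s : ℝ) : ℂ)) volume a b := by
    intro F A hF hA
    refine ContinuousOn.intervalIntegrable ?_
    rw [Set.uIcc_of_le hab]
    refine ContinuousOn.add (hF.comp (by fun_prop) fun s hs => ?_)
      (hF.comp (by fun_prop) fun s hs => ?_)
    · have : 0 < s := ha.trans_le hs.1
      exact hA _ (by simpa [abs_of_pos this] using hs.1) (by simpa [abs_of_pos this] using hs.2)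
        (by simp)
    · have : 0 < s := ha.trans_le hs.1
      exact hA _ (by simpa [abs_of_pos this] using hs.1) (by simpa [abs_of_pos this] using hs.2)
        (by simp)
  rw [symmIntegral, symmIntegral, symmIntegral, ← intervalIntegral.integral_sub
    (key hu fun ζ h1 h2 h3 => hAu ζ h1 h2 h3.ge) (key hl fun ζ h1 h2 h3 => hAl ζ h1 h2 h3.le)]
  refine intervalIntegral.integral_congr fun s _ => ?_
  ring

theorem circleMap_mem_upper {r φ : ℝ} (hr : 0 < r) (hφ : φ ∈ Set.Icc 0 Real.pi) :
    0 ≤ (circleMap 0 r φ).im := by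
  rw [circleMap_zero_im]
  exact mul_nonneg hr.le (Real.sin_nonneg_of_mem_Icc hφ)

theorem circleMap_mem_lower {r φ : ℝ} (hr : 0 < r)
    (hφ : φ ∈ Set.Icc Real.pi (2 * Real.pi)) : (circleMap 0 r φ).im ≤ 0 := by
  rw [circleMap_zero_im]
  exact mul_nonpos_of_nonneg_of_nonpos hr.le (sin_nonpos_of_mem_Icc hφ)

theorem pi_le_two_pi : Real.pi ≤ 2 * Real.pi := by linarith [Real.pi_pos]

/-- Two functions holomorphic in the upper and the lower half of the disc `|ζ| < q`. -/
theorem integral_sub_inside (hq : 0 < q) (hu : ContinuousOn Fu Au) (hl : ContinuousOn Fl Al)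
    (hdu : ∀ ζ ∈ Du, DifferentiableAt ℂ Fu ζ) (hdl : ∀ ζ ∈ Dl, DifferentiableAt ℂ Fl ζ)
    (hAu : ∀ ζ : ℂ, 0 < ‖ζ‖ → ‖ζ‖ ≤ q → 0 ≤ ζ.im → ζ ∈ Au)
    (hAl : ∀ ζ : ℂ, 0 < ‖ζ‖ → ‖ζ‖ ≤ q → ζ.im ≤ 0 → ζ ∈ Al)
    (hDu : ∀ ζ : ℂ, 0 < ‖ζ‖ → ‖ζ‖ < q → 0 < ζ.im → ζ ∈ Du)
    (hDl : ∀ ζ : ℂ, 0 < ‖ζ‖ → ‖ζ‖ < q → ζ.im < 0 → ζ ∈ Dl)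
    (h0u : Tendsto (fun ζ => ζ * Fu ζ) (𝓝[≠] 0 ⊓ 𝓟 Au) (𝓝 0))
    (h0l : Tendsto (fun ζ => ζ * Fl ζ) (𝓝[≠] 0 ⊓ 𝓟 Al) (𝓝 0))
    (hint : Integrable fun s : ℝ => Fu s - Fl s) :
    (∫ s in (-q)..q, (Fu (s : ℝ) - Fl (s : ℝ)))
      = -arcIntegral Fu 0 Real.pi q - arcIntegral Fl Real.pi (2 * Real.pi) q := by
  have h1 := tendsto_symmIntegral_zero (Φ := fun ζ => Fu ζ - Fl ζ) hint q
  have hau := tendsto_arcIntegral (l := 𝓝[>] 0) Real.pi_pos.le hu (by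
    filter_upwards [Ioo_mem_nhdsGT hq] with r hr
    refine ⟨hr.1, fun φ hφ => hAu _ ?_ ?_ (circleMap_mem_upper hr.1 hφ)⟩ <;>
      rw [norm_circleMap_zero_of_pos hr.1]
    · exact hr.1
    · exact hr.2.le) eventually_circleMap_mem_nhds_zero h0u
  have hal := tendsto_arcIntegral (l := 𝓝[>] 0) pi_le_two_pi hl (by
    filter_upwards [Ioo_mem_nhdsGT hq] with r hr
    refine ⟨hr.1, fun φ hφ => hAl _ ?_ ?_ (circleMap_mem_lower hr.1 hφ)⟩ <;>
      rw [norm_circleMap_zero_of_pos hr.1]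
    · exact hr.1
    · exact hr.2.le) eventually_circleMap_mem_nhds_zero h0l
  rw [mul_zero] at hau hal
  have h2 := ((hau.sub_const (arcIntegral Fu 0 Real.pi q)).sub_const
    (arcIntegral Fl Real.pi (2 * Real.pi) q)).add hal
  rw [zero_sub, add_zero] at h2
  -- Before the limit `a → 0`, Cauchy's theorem expresses the truncated integral through arcs of
  -- radius `a` and `q`; the former vanish in the limit.
  refine tendsto_nhds_unique h1 (h2.congr' ?_)
  filter_upwards [Ioo_mem_nhdsGT hq] with a ha
  have hAu' : ∀ ζ : ℂ, a ≤ ‖ζ‖ → ‖ζ‖ ≤ q → 0 ≤ ζ.im → ζ ∈ Au :=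
    fun ζ h => hAu ζ (ha.1.trans_le h)
  have hAl' : ∀ ζ : ℂ, a ≤ ‖ζ‖ → ‖ζ‖ ≤ q → ζ.im ≤ 0 → ζ ∈ Al :=
    fun ζ h => hAl ζ (ha.1.trans_le h)
  rw [symmIntegral_sub ha.1 ha.2.le hu hl hAu' hAl']
  have e1 := symmIntegral_add_arc_upper ha.1 ha.2.le hu hdu hAu' fun ζ h => hDu ζ (ha.1.trans h)
  have e2 := symmIntegral_sub_arc_lower ha.1 ha.2.le hl hdl hAl' fun ζ h => hDl ζ (ha.1.trans h)
  linear_combination e2 - e1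

/-- Two functions holomorphic in the upper and the lower half of the exterior `|ζ| > q`. -/
theorem integral_sub_outside {L : ℂ} (hq : 0 < q) (hu : ContinuousOn Fu Au)
    (hl : ContinuousOn Fl Al)
    (hdu : ∀ ζ ∈ Du, DifferentiableAt ℂ Fu ζ) (hdl : ∀ ζ ∈ Dl, DifferentiableAt ℂ Fl ζ)
    (hAu : ∀ ζ : ℂ, q ≤ ‖ζ‖ → 0 ≤ ζ.im → ζ ∈ Au) (hAl : ∀ ζ : ℂ, q ≤ ‖ζ‖ → ζ.im ≤ 0 → ζ ∈ Al)
    (hDu : ∀ ζ : ℂ, q < ‖ζ‖ → 0 < ζ.im → ζ ∈ Du) (hDl : ∀ ζ : ℂ, q < ‖ζ‖ → ζ.im < 0 → ζ ∈ Dl)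
    (hLu : Tendsto (fun ζ => ζ * Fu ζ) (cocompact ℂ ⊓ 𝓟 Au) (𝓝 L))
    (hLl : Tendsto (fun ζ => ζ * Fl ζ) (cocompact ℂ ⊓ 𝓟 Al) (𝓝 L))
    (hint : Integrable fun s : ℝ => Fu s - Fl s) :
    (∫ s in {s : ℝ | q < |s|}, (Fu (s : ℝ) - Fl (s : ℝ)))
      = arcIntegral Fu 0 Real.pi q + arcIntegral Fl Real.pi (2 * Real.pi) q
        - 2 * Real.pi * Complex.I * L := by
  have h1 := tendsto_symmIntegral_atTop (Φ := fun ζ => Fu ζ - Fl ζ) hint hq.le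
  have hau := tendsto_arcIntegral (l := atTop) Real.pi_pos.le hu (by
    filter_upwards [eventually_ge_atTop q] with r hr
    refine ⟨hq.trans_le hr, fun φ hφ => hAu _ ?_ (circleMap_mem_upper (hq.trans_le hr) hφ)⟩
    rwa [norm_circleMap_zero_of_pos (hq.trans_le hr)]) eventually_circleMap_mem_cocompact hLu
  have hal := tendsto_arcIntegral (l := atTop) pi_le_two_pi hl (by
    filter_upwards [eventually_ge_atTop q] with r hr
    refine ⟨hq.trans_le hr, fun φ hφ => hAl _ ?_ (circleMap_mem_lower (hq.trans_le hr) hφ)⟩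
    rwa [norm_circleMap_zero_of_pos (hq.trans_le hr)]) eventually_circleMap_mem_cocompact hLl
  have h2 := (tendsto_const_nhds (x := arcIntegral Fu 0 Real.pi q
    + arcIntegral Fl Real.pi (2 * Real.pi) q)).sub (hau.add hal)
  refine (tendsto_nhds_unique h1 (h2.congr' ?_)).trans ?_
  · filter_upwards [eventually_ge_atTop q] with b hb
    rw [symmIntegral_sub hq hb hu hl (fun ζ h _ => hAu ζ h) (fun ζ h _ => hAl ζ h)]
    have e1 := symmIntegral_add_arc_upper hq hb hu hdu (fun ζ h _ => hAu ζ h)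
      fun ζ h _ => hDu ζ h
    have e2 := symmIntegral_sub_arc_lower hq hb hl hdl (fun ζ h _ => hAl ζ h)
      fun ζ h _ => hDl ζ h
    linear_combination e2 - e1
  · push_cast
    ring

theorem arcIntegral_sub {α β : ℝ}
    (hu : ContinuousOn Fu Au) (hl : ContinuousOn Fl Al)
    (hAu : ∀ φ, circleMap 0 q φ ∈ Au) (hAl : ∀ φ, circleMap 0 q φ ∈ Al) :
    arcIntegral (fun ζ => Fu ζ - Fl ζ) α β q = arcIntegral Fu α β q - arcIntegral Fl α β q := by
  have key : ∀ {F : ℂ → ℂ} {A : Set ℂ}, ContinuousOn F A → (∀ φ, circleMap 0 q φ ∈ A) →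
      IntervalIntegrable (fun φ => deriv (circleMap 0 q) φ * F (circleMap 0 q φ)) volume α β := by
    intro F A hF hA
    refine ContinuousOn.intervalIntegrable ?_
    simp only [deriv_circleMap]
    exact ContinuousOn.mul (by fun_prop)
      (hF.comp (continuous_circleMap 0 q).continuousOn fun φ _ => hA φ)
  rw [arcIntegral, arcIntegral, arcIntegral, ← intervalIntegral.integral_sub (key hu hAu)
    (key hl hAl)]
  simp only [mul_sub]

end HalfPlanes

/-! ### Assembling the contour `Σ`. -/

namespace Background

variable (B : Background)

theorem sign_mul : B.δ * B.σ = 1 ∨ B.δ * B.σ = -1 := by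
  rcases B.delta_sign with h | h <;> rcases B.sigma_sign with h' | h' <;> simp [h, h']

end Background

/-- The integral over `Σ` of the jump of a sectionally holomorphic function which is `o(1/ζ)` at
the origin and asymptotic to `L/ζ` at infinity. -/
theorem contourIntegral_sub_eq (B : Background) {Fp Fm : ℂ → ℂ} {L : ℂ}
    (hcp : ContinuousOn Fp (B.Dplus ∪ B.Sigma)) (hcm : ContinuousOn Fm (B.Dminus ∪ B.Sigma))
    (hdp : ∀ ζ ∈ B.Dplus, DifferentiableAt ℂ Fp ζ) (hdm : ∀ ζ ∈ B.Dminus, DifferentiableAt ℂ Fm ζ)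
    (h0p : Tendsto (fun ζ => ζ * Fp ζ) (𝓝[≠] 0 ⊓ 𝓟 (B.Dplus ∪ B.Sigma)) (𝓝 0))
    (h0m : Tendsto (fun ζ => ζ * Fm ζ) (𝓝[≠] 0 ⊓ 𝓟 (B.Dminus ∪ B.Sigma)) (𝓝 0))
    (hLp : Tendsto (fun ζ => ζ * Fp ζ) (cocompact ℂ ⊓ 𝓟 (B.Dplus ∪ B.Sigma)) (𝓝 L))
    (hLm : Tendsto (fun ζ => ζ * Fm ζ) (cocompact ℂ ⊓ 𝓟 (B.Dminus ∪ B.Sigma)) (𝓝 L))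
    (hint : Integrable fun s : ℝ => Fp s - Fm s) :
    contourIntegral B (fun ζ => Fp ζ - Fm ζ) = -(2 * Real.pi * Complex.I * L) := by
  have hq := B.q₀_pos
  rcases B.sign_mul with hs | hs
  · have hAp : ∀ ζ : ℂ, 0 < ‖ζ‖ → 0 ≤ ζ.im → ζ ∈ B.Dplus ∪ B.Sigma := by
      intro ζ h0 h
      simp only [Background.Dplus, Background.Sigma, if_pos hs, Set.mem_union, Set.mem_ofPred_eq]
      rcases h.lt_or_eq with h | h
      · exact Or.inl h
      · exact Or.inr ⟨h.symm, norm_pos_iff.1 h0⟩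
    have hAm : ∀ ζ : ℂ, 0 < ‖ζ‖ → ζ.im ≤ 0 → ζ ∈ B.Dminus ∪ B.Sigma := by
      intro ζ h0 h
      simp only [Background.Dminus, Background.Sigma, if_pos hs, Set.mem_union, Set.mem_ofPred_eq]
      rcases h.lt_or_eq with h | h
      · exact Or.inl h
      · exact Or.inr ⟨h, norm_pos_iff.1 h0⟩
    have hDp : ∀ ζ : ℂ, 0 < ζ.im → ζ ∈ B.Dplus := by
      intro ζ h
      simpa only [Background.Dplus, if_pos hs, Set.mem_ofPred_eq] using h
    have hDm : ∀ ζ : ℂ, ζ.im < 0 → ζ ∈ B.Dminus := by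
      intro ζ h
      simpa only [Background.Dminus, if_pos hs, Set.mem_ofPred_eq] using h
    -- For `δσ = 1` the circle `|ζ| = q₀` is only an auxiliary cut, and its arc integrals cancel
    -- between the two pieces.
    have hin := integral_sub_inside hq hcp hcm hdp hdm (fun ζ h _ => hAp ζ h)
      (fun ζ h _ => hAm ζ h) (fun ζ _ _ => hDp ζ) (fun ζ _ _ => hDm ζ) h0p h0m hint
    have hout := integral_sub_outside hq hcp hcm hdp hdm (fun ζ h => hAp ζ (hq.trans_le h))
      (fun ζ h => hAm ζ (hq.trans_le h)) (fun ζ _ => hDp ζ) (fun ζ _ => hDm ζ) hLp hLm hint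
    have hsplit : (∫ s : ℝ, (Fp s - Fm s))
        = (∫ s in (-B.q₀)..B.q₀, (Fp (s : ℝ) - Fm (s : ℝ)))
          + ∫ s in {s : ℝ | B.q₀ < |s|}, (Fp (s : ℝ) - Fm (s : ℝ)) := by
      have hset : {s : ℝ | B.q₀ < |s|} = (Set.Icc (-B.q₀) B.q₀)ᶜ := by
        ext s
        simp [← abs_le]
      rw [hset, intervalIntegral.integral_of_le (by linarith), ← integral_Icc_eq_integral_Ioc,
        integral_add_compl measurableSet_Icc hint]
    rw [contourIntegral, if_pos hs, hsplit, hin, hout]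
    ring
  · have hs' : ¬ B.δ * B.σ = 1 := by rw [hs]; norm_num
    have mem_real : ∀ ζ : ℂ, 0 < ‖ζ‖ → ζ.im = 0 → ζ ∈ B.Sigma := by
      intro ζ h0 h
      simp only [Background.Sigma, if_neg hs']
      exact Or.inl ⟨h, norm_pos_iff.1 h0⟩
    have mem_circle : ∀ ζ : ℂ, ‖ζ‖ = B.q₀ → ζ ∈ B.Sigma := by
      intro ζ h
      simp only [Background.Sigma, if_neg hs']
      exact Or.inr h
    have hDpu : ∀ ζ : ℂ, B.q₀ < ‖ζ‖ → 0 < ζ.im → ζ ∈ B.Dplus := by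
      intro ζ h1 h2
      simp only [Background.Dplus, if_neg hs']
      exact mul_pos (sub_pos.2 h1) h2
    have hDpl : ∀ ζ : ℂ, ‖ζ‖ < B.q₀ → ζ.im < 0 → ζ ∈ B.Dplus := by
      intro ζ h1 h2
      simp only [Background.Dplus, if_neg hs']
      exact mul_pos_of_neg_of_neg (sub_neg.2 h1) h2
    have hDml : ∀ ζ : ℂ, B.q₀ < ‖ζ‖ → ζ.im < 0 → ζ ∈ B.Dminus := by
      intro ζ h1 h2
      simp only [Background.Dminus, if_neg hs']
      exact mul_neg_of_pos_of_neg (sub_pos.2 h1) h2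
    have hDmu : ∀ ζ : ℂ, ‖ζ‖ < B.q₀ → 0 < ζ.im → ζ ∈ B.Dminus := by
      intro ζ h1 h2
      simp only [Background.Dminus, if_neg hs']
      exact mul_neg_of_neg_of_pos (sub_neg.2 h1) h2
    have hout := integral_sub_outside hq hcp hcm hdp hdm
      (fun ζ h1 h2 => by
        rcases h1.lt_or_eq with h1' | h1'
        · rcases h2.lt_or_eq with h2' | h2'
          · exact Or.inl (hDpu ζ h1' h2')
          · exact Or.inr (mem_real ζ (hq.trans_le h1) h2'.symm)
        · exact Or.inr (mem_circle ζ h1'.symm))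
      (fun ζ h1 h2 => by
        rcases h1.lt_or_eq with h1' | h1'
        · rcases h2.lt_or_eq with h2' | h2'
          · exact Or.inl (hDml ζ h1' h2')
          · exact Or.inr (mem_real ζ (hq.trans_le h1) h2')
        · exact Or.inr (mem_circle ζ h1'.symm)) hDpu hDml hLp hLm hint
    -- Inside the circle the upper half belongs to `D₋` and the lower half to `D₊`, so the two
    -- functions exchange roles. The arcs left over from inside and outside cancel against the
    -- circle part of `Σ`.
    have hin := integral_sub_inside hq hcm hcp hdm hdp
      (fun ζ h0 h1 h2 => by
        rcases h1.lt_or_eq with h1' | h1'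
        · rcases h2.lt_or_eq with h2' | h2'
          · exact Or.inl (hDmu ζ h1' h2')
          · exact Or.inr (mem_real ζ h0 h2'.symm)
        · exact Or.inr (mem_circle ζ h1'))
      (fun ζ h0 h1 h2 => by
        rcases h1.lt_or_eq with h1' | h1'
        · rcases h2.lt_or_eq with h2' | h2'
          · exact Or.inl (hDpl ζ h1' h2')
          · exact Or.inr (mem_real ζ h0 h2')
        · exact Or.inr (mem_circle ζ h1')) (fun ζ _ => hDmu ζ) (fun ζ _ => hDpl ζ) h0m h0p
      (hint.neg.congr (Eventually.of_forall fun s => by simp))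
    have hcirc : ∀ φ, circleMap 0 B.q₀ φ ∈ B.Sigma :=
      fun φ => mem_circle _ (norm_circleMap_zero_of_pos hq φ)
    have hau := arcIntegral_sub (α := 0) (β := Real.pi) hcp hcm (fun φ => Or.inr (hcirc φ))
      (fun φ => Or.inr (hcirc φ))
    have hal := arcIntegral_sub (α := Real.pi) (β := 2 * Real.pi) hcp hcm (fun φ => Or.inr (hcirc φ))
      (fun φ => Or.inr (hcirc φ))
    have hneg : (∫ s in (-B.q₀)..B.q₀, (Fp (s : ℝ) - Fm (s : ℝ)))
        = -∫ s in (-B.q₀)..B.q₀, (Fm (s : ℝ) - Fp (s : ℝ)) := by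
      rw [← intervalIntegral.integral_neg]
      simp
    rw [arcIntegral] at hau hal
    rw [contourIntegral, if_neg hs', intervalIntegral.integral_symm 0 Real.pi, hau, hal, hout,
      hneg, hin]
    ring

/-! ### Simple poles, polar parts and removable singularities. -/

theorem exists_analyticAt_eventuallyEq_slope {h : ℂ → ℂ} {z₀ : ℂ} (hh : AnalyticAt ℂ h z₀) :
    ∃ g : ℂ → ℂ, AnalyticAt ℂ g z₀ ∧ ∀ z, z ≠ z₀ → h z = h z₀ + (z - z₀) * g z := by
  obtain ⟨p, hp⟩ := hh
  refine ⟨dslope h z₀, ⟨_, hp.has_fpower_series_dslope_fslope⟩, fun z hz => ?_⟩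
  rw [dslope_of_ne _ hz, slope_def_field]
  field_simp [sub_ne_zero.2 hz]
  ring

/-- The decomposition of a function with at most a simple pole into its polar part and an analytic
function. -/
theorem exists_residue_decomposition {f : ℂ → ℂ} {z₀ : ℂ} (hf : MeromorphicAt f z₀)
    (ho : (-1 : WithTop ℤ) ≤ meromorphicOrderAt f z₀) :
    ∃ (r : ℂ) (g : ℂ → ℂ), AnalyticAt ℂ g z₀ ∧ (f =ᶠ[𝓝[≠] z₀] fun z => r / (z - z₀) + g z) ∧
      Tendsto (fun z => (z - z₀) * f z) (𝓝[≠] z₀) (𝓝 r) := by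
  have hid : MeromorphicAt (fun z : ℂ => z - z₀) z₀ := by fun_prop
  -- Multiplication by `z - z₀` raises the order by one; the value at `z₀` of the resulting analytic
  -- function is the residue.
  have hnn : 0 ≤ meromorphicOrderAt (fun z => (z - z₀) * f z) z₀ := by
    have h2 : meromorphicOrderAt (fun z => (z - z₀) * f z) z₀ = _ := meromorphicOrderAt_mul hid hf
    rw [h2]
    have h1 : meromorphicOrderAt (fun z : ℂ => z - z₀) z₀ = 1 := meromorphicOrderAt_id_sub_const
    rw [h1]
    calc (0 : WithTop ℤ) = 1 + (-1) := by rfl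
      _ ≤ _ := by gcongr
  obtain ⟨h, hh, hfh⟩ := ((hid.fun_mul hf).meromorphicOrderAt_nonneg_iff).1 hnn
  obtain ⟨g, hg, hhg⟩ := exists_analyticAt_eventuallyEq_slope hh
  refine ⟨h z₀, g, hg, ?_, ?_⟩
  · filter_upwards [hfh, self_mem_nhdsWithin] with z hz hne
    have hne' : z - z₀ ≠ 0 := sub_ne_zero.2 hne
    rw [hhg z hne] at hz
    field_simp
    linear_combination hz
  · exact (hh.continuousAt.tendsto.mono_left nhdsWithin_le_nhds).congr' (hfh.mono fun _ h => h.symm)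

/-- The rational function `d + r₀ / ζ + ∑ a_k / (ζ - p_k)`. -/
def polarSum {ι : Type*} [Fintype ι] (d r₀ : ℂ) (a p : ι → ℂ) (ζ : ℂ) : ℂ :=
  d + r₀ / ζ + ∑ k, a k / (ζ - p k)

section PolarSum

variable {ι : Type*} [Fintype ι] {d r₀ : ℂ} {a p : ι → ℂ}

theorem tendsto_div_sub_cocompact (a p : ℂ) :
    Tendsto (fun ζ => a / (ζ - p)) (cocompact ℂ) (𝓝 0) := by
  rw [← Metric.cobounded_eq_cocompact]
  have h := (tendsto_inv₀_cobounded (α := ℂ)).comp (tendsto_sub_const_cobounded p)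
  simpa [div_eq_mul_inv] using h.const_mul a

theorem tendsto_polarSum_cocompact : Tendsto (polarSum d r₀ a p) (cocompact ℂ) (𝓝 d) := by
  have h0 := tendsto_div_sub_cocompact r₀ 0
  simp only [sub_zero] at h0
  have hs := tendsto_finsetSum Finset.univ fun k _ => tendsto_div_sub_cocompact (a k) (p k)
  have h := ((tendsto_const_nhds (x := d)).add h0).add hs
  simp only [Finset.sum_const_zero, add_zero] at h
  exact h

omit [Fintype ι] in
theorem analyticAt_sum_div_sub (s : Finset ι) {ζ : ℂ} (hp : ∀ k ∈ s, ζ ≠ p k) :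
    AnalyticAt ℂ (fun ζ => ∑ k ∈ s, a k / (ζ - p k)) ζ := by
  refine Finset.analyticAt_fun_sum _ fun k hk => ?_
  exact analyticAt_const.fun_div (analyticAt_id.fun_sub analyticAt_const) (sub_ne_zero.2 (hp k hk))

theorem analyticAt_polarSum {ζ : ℂ} (h0 : ζ ≠ 0) (hp : ∀ k, ζ ≠ p k) :
    AnalyticAt ℂ (polarSum d r₀ a p) ζ :=
  (analyticAt_const.fun_add (analyticAt_const.fun_div analyticAt_id h0)).fun_add
    (analyticAt_sum_div_sub Finset.univ fun k _ => hp k)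

theorem tendsto_mul_polarSum_zero (hp : ∀ k, p k ≠ 0) :
    Tendsto (fun ζ => ζ * polarSum d r₀ a p ζ) (𝓝[≠] 0) (𝓝 r₀) := by
  have h1 : ContinuousAt (fun ζ => ζ * d + r₀ + ζ * ∑ k, a k / (ζ - p k)) 0 := by
    have := (analyticAt_sum_div_sub (a := a) (p := p) Finset.univ
      fun k _ => (hp k).symm).continuousAt
    fun_prop
  have h2 := h1.tendsto.mono_left (nhdsWithin_le_nhds (s := {0}ᶜ))
  simp only [zero_mul, zero_add, add_zero] at h2
  refine h2.congr' ?_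
  filter_upwards [self_mem_nhdsWithin] with ζ hζ
  have hζ' : ζ ≠ 0 := hζ
  rw [polarSum, mul_add, mul_add, mul_div_cancel₀ _ hζ']

/-- At `p k` the `k`-th summand cancels the polar part of `f`, and injectivity of `p` makes all
other summands analytic there. -/
theorem exists_analyticAt_sub_polarSum {D : Set ℂ} {f : ℂ → ℂ} (hinj : Function.Injective p)
    (h0 : (0 : ℂ) ∉ D) (hf : ∀ ζ ∈ D, ζ ∉ Set.range p → AnalyticAt ℂ f ζ)
    (hres : ∀ k, p k ∈ D → ∃ g : ℂ → ℂ, AnalyticAt ℂ g (p k) ∧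
      f =ᶠ[𝓝[≠] (p k)] fun ζ => a k / (ζ - p k) + g ζ) {ζ : ℂ} (hζ : ζ ∈ D) :
    ∃ g : ℂ → ℂ, AnalyticAt ℂ g ζ ∧ (fun w => f w - polarSum d r₀ a p w) =ᶠ[𝓝[≠] ζ] g := by
  classical
  have hζ0 : ζ ≠ 0 := fun h => h0 (h ▸ hζ)
  by_cases hp : ζ ∈ Set.range p
  · obtain ⟨k, rfl⟩ := hp
    obtain ⟨g, hg, hfg⟩ := hres k hζ
    refine ⟨fun w => g w - (d + r₀ / w + ∑ j ∈ Finset.univ.erase k, a j / (w - p j)), ?_, ?_⟩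
    · refine hg.fun_sub ((analyticAt_const.fun_add
        (analyticAt_const.fun_div analyticAt_id hζ0)).fun_add (analyticAt_sum_div_sub _ ?_))
      intro j hj h
      exact (Finset.mem_erase.1 hj).1 (hinj h.symm)
    · filter_upwards [hfg] with w hw
      rw [hw, polarSum, ← Finset.add_sum_erase _ _ (Finset.mem_univ k)]
      ring
  · exact ⟨_, (hf ζ hζ hp).fun_sub (analyticAt_polarSum hζ0 fun k h => hp ⟨k, h.symm⟩),
      EventuallyEq.rfl⟩

end PolarSum

/-- Removal of finitely many removable singularities, keeping the boundary values. -/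
theorem exists_extension {D T P : Set ℂ} {f : ℂ → ℂ} (hD : IsOpen D) (hP : P.Finite)
    (hPT : Disjoint P T) (hc : ContinuousOn f ((D ∪ T) \ P))
    (h : ∀ ζ ∈ D, ∃ g : ℂ → ℂ, AnalyticAt ℂ g ζ ∧ f =ᶠ[𝓝[≠] ζ] g) :
    ∃ F : ℂ → ℂ, ContinuousOn F (D ∪ T) ∧ (∀ ζ ∈ D, DifferentiableAt ℂ F ζ) ∧
      ∀ ζ, ζ ∉ P → F ζ = f ζ := by
  classical
  -- The values of `f` on `P` are arbitrary and are replaced by limits. Since `P` is finite and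
  -- misses `T`, nothing changes near a point of `T`.
  let F : ℂ → ℂ := fun ζ => if ζ ∈ P then limUnder (𝓝[≠] ζ) f else f ζ
  have hF : ∀ ζ, ζ ∉ P → F ζ = f ζ := fun ζ hζ => if_neg hζ
  have han : ∀ ζ ∈ D, AnalyticAt ℂ F ζ := by
    intro ζ hζ
    obtain ⟨g, hg, hfg⟩ := h ζ hζ
    have hlim : Tendsto f (𝓝[≠] ζ) (𝓝 (g ζ)) :=
      (hg.continuousAt.tendsto.mono_left nhdsWithin_le_nhds).congr' (hfg.mono fun _ h => h.symm)
    have h1 : ∀ᶠ w in 𝓝[≠] ζ, F w = g w := by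
      have hfin : ∀ᶠ w in 𝓝[≠] ζ, w ∉ P := by
        have hcl : (P \ {ζ})ᶜ ∈ 𝓝 ζ :=
          (hP.subset Set.sdiff_subset).isClosed.isOpen_compl.mem_nhds (by simp)
        filter_upwards [nhdsWithin_le_nhds hcl, self_mem_nhdsWithin] with w hw hne hwP
        exact hw ⟨hwP, hne⟩
      filter_upwards [hfg, hfin] with w hw hwP
      rw [hF w hwP, hw]
    have h2 : F ζ = g ζ := by
      by_cases hζP : ζ ∈ P
      · exact (if_pos hζP).trans hlim.limUnder_eq
      · rw [hF ζ hζP]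
        have hca : ContinuousAt f ζ := by
          refine hc.continuousAt ?_
          filter_upwards [hD.mem_nhds hζ, hP.isClosed.isOpen_compl.mem_nhds hζP] with w h1 h2
          exact ⟨Or.inl h1, h2⟩
        exact tendsto_nhds_unique (hca.tendsto.mono_left nhdsWithin_le_nhds) hlim
    refine hg.congr ?_
    rw [eventually_nhdsWithin_iff] at h1
    filter_upwards [h1] with w hw
    by_cases hne : w = ζ
    · rw [hne, h2]
    · exact (hw hne).symm
  refine ⟨F, ?_, fun ζ hζ => (han ζ hζ).differentiableAt, hF⟩
  intro ζ hζ
  rcases hζ with hζ | hζ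
  · exact (han ζ hζ).continuousAt.continuousWithinAt
  · have hζP : ζ ∉ P := fun h => hPT.le_bot ⟨h, hζ⟩
    have hnh : Pᶜ ∈ 𝓝 ζ := hP.isClosed.isOpen_compl.mem_nhds hζP
    have h1 : ContinuousWithinAt f (D ∪ T) ζ := by
      have := hc ζ ⟨Or.inr hζ, hζP⟩
      rwa [Set.sdiff_eq, continuousWithinAt_inter hnh] at this
    refine h1.congr_of_eventuallyEq ?_ (hF ζ hζP)
    filter_upwards [nhdsWithin_le_nhds hnh] with w hw using hF w hw

/-- The Cauchy quotient of a function with prescribed simple poles, after subtraction of its polar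
part and of the pole at `z`. -/
theorem exists_cauchyQuotient {ι : Type*} [Fintype ι] {d r₀ c z : ℂ} {a p : ι → ℂ} {D T : Set ℂ}
    {f : ℂ → ℂ} (hinj : Function.Injective p) (hp0 : ∀ k, p k ≠ 0) (hpT : ∀ k, p k ∉ T)
    (hz0 : z ≠ 0) (hzT : z ∉ T) (hzp : z ∉ Set.range p) (hD : IsOpen D) (h0 : (0 : ℂ) ∉ D ∪ T)
    (hf : ∀ ζ ∈ D, ζ ∉ Set.range p → AnalyticAt ℂ f ζ)
    (hc : ContinuousOn f ((D ∪ T) \ Set.range p))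
    (hres : ∀ k, p k ∈ D → ∃ g : ℂ → ℂ, AnalyticAt ℂ g (p k) ∧
      f =ᶠ[𝓝[≠] (p k)] fun ζ => a k / (ζ - p k) + g ζ)
    (hz : z ∈ D → f z - polarSum d r₀ a p z = c)
    (hf0 : Tendsto (fun ζ => ζ * f ζ) (𝓝[≠] 0 ⊓ 𝓟 (D ∪ T)) (𝓝 r₀))
    (hfinf : Tendsto f (cocompact ℂ ⊓ 𝓟 (D ∪ T)) (𝓝 d)) :
    ∃ F : ℂ → ℂ, ContinuousOn F (D ∪ T) ∧ (∀ ζ ∈ D, DifferentiableAt ℂ F ζ) ∧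
      (∀ ζ ∈ T, F ζ = (f ζ - polarSum d r₀ a p ζ - c) / (ζ - z)) ∧
      Tendsto (fun ζ => ζ * F ζ) (𝓝[≠] 0 ⊓ 𝓟 (D ∪ T)) (𝓝 0) ∧
      Tendsto (fun ζ => ζ * F ζ) (cocompact ℂ ⊓ 𝓟 (D ∪ T)) (𝓝 (-c)) := by
  set R := polarSum d r₀ a p with hR
  let P : Set ℂ := insert z (Set.range p)
  have hPfin : P.Finite := (Set.finite_range p).insert z
  obtain ⟨F, hFc, hFd, hFf⟩ := exists_extension (T := T)
    (f := fun ζ => (f ζ - R ζ - c) / (ζ - z)) hD hPfin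
    (by
      rw [Set.disjoint_left]
      rintro w (rfl | ⟨k, rfl⟩)
      exacts [hzT, hpT k])
    (by
      refine ContinuousOn.div ((((hc.mono ?_).sub ?_)).sub continuousOn_const) (by fun_prop) ?_
      · exact fun w hw => ⟨hw.1, fun h => hw.2 (Or.inr h)⟩
      · intro w hw
        refine (analyticAt_polarSum (fun h => h0 (h ▸ hw.1)) fun k h =>
          hw.2 (Or.inr ⟨k, h.symm⟩)).continuousAt.continuousWithinAt
      · exact fun w hw => sub_ne_zero.2 fun h => hw.2 (Or.inl h))
    (by
      intro ζ hζ
      by_cases hζz : ζ = z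
      · subst hζz
        have han := (hf ζ hζ hzp).fun_sub
          (analyticAt_polarSum (d := d) (r₀ := r₀) (a := a) hz0 fun k h => hzp ⟨k, h.symm⟩)
        obtain ⟨g, hg, hfg⟩ := exists_analyticAt_eventuallyEq_slope han
        refine ⟨g, hg, ?_⟩
        filter_upwards [self_mem_nhdsWithin] with w hw
        have := hfg w hw
        rw [hz hζ] at this
        rw [this, add_sub_cancel_left, mul_div_cancel_left₀ _ (sub_ne_zero.2 hw)]
      · obtain ⟨g, hg, hfg⟩ := exists_analyticAt_sub_polarSum (d := d) (r₀ := r₀) hinj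
          (fun h => h0 (Or.inl h)) hf hres hζ
        refine ⟨fun w => (g w - c) / (w - z), (hg.fun_sub analyticAt_const).fun_div
          (analyticAt_id.fun_sub analyticAt_const) (sub_ne_zero.2 hζz), ?_⟩
        filter_upwards [hfg] with w hw
        rw [hw])
  refine ⟨F, hFc, hFd, fun ζ hζ => hFf ζ ?_, ?_, ?_⟩
  · rintro (rfl | ⟨k, rfl⟩)
    exacts [hzT hζ, hpT k hζ]
  · have h1 : Tendsto (fun ζ => (ζ * f ζ - ζ * R ζ - ζ * c) / (ζ - z)) (𝓝[≠] 0 ⊓ 𝓟 (D ∪ T))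
        (𝓝 ((r₀ - r₀ - 0 * c) / (0 - z))) := by
      have hid : Tendsto (fun ζ : ℂ => ζ) (𝓝[≠] 0 ⊓ 𝓟 (D ∪ T)) (𝓝 0) :=
        inf_le_left.trans nhdsWithin_le_nhds
      exact ((hf0.sub ((tendsto_mul_polarSum_zero hp0).mono_left inf_le_left)).sub
        (hid.mul_const c)).div (hid.sub_const z) (by simpa using hz0)
    rw [sub_self, zero_mul, sub_zero, zero_div] at h1
    refine h1.congr' ?_
    have hP0 : Pᶜ ∈ 𝓝 (0 : ℂ) := hPfin.isClosed.isOpen_compl.mem_nhds (by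
      rintro (h | ⟨k, h⟩)
      exacts [hz0 h.symm, hp0 k h])
    filter_upwards [inf_le_left (b := 𝓟 (D ∪ T)) (nhdsWithin_le_nhds (s := {0}ᶜ) hP0)] with w hw
    rw [hFf w hw]
    ring
  · have h1 : Tendsto (fun ζ => (f ζ - R ζ - c) * (1 + z / (ζ - z))) (cocompact ℂ ⊓ 𝓟 (D ∪ T))
        (𝓝 ((d - d - c) * (1 + 0))) :=
      ((hfinf.sub (tendsto_polarSum_cocompact.mono_left inf_le_left)).sub_const c).mul
        (((tendsto_div_sub_cocompact z z).mono_left inf_le_left).const_add 1)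
    rw [sub_self, zero_sub, add_zero, mul_one] at h1
    refine h1.congr' ?_
    filter_upwards [inf_le_left (b := 𝓟 (D ∪ T)) hPfin.isCompact.compl_mem_cocompact] with w hw
    have hwz : w - z ≠ 0 := sub_ne_zero.2 fun h => hw (Or.inl h)
    rw [hFf w hw]
    field_simp
    ring

/-! ### An integrability criterion on the punctured line. -/

theorem integrable_of_continuousOn_isBigO {h : ℝ → ℂ} (hc : ContinuousOn h {0}ᶜ)
    (h0 : h =O[𝓝[≠] 0] fun _ => (1 : ℝ)) (hinf : h =O[cocompact ℝ] fun s => (1 + s ^ 2)⁻¹) :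
    Integrable h := by
  -- The value of `h` at `0` is unconstrained; resetting it does not affect the integral.
  let k : ℝ → ℂ := Function.update h 0 0
  have hk : ∀ s, s ≠ 0 → k s = h s := fun s hs => Function.update_of_ne hs _ _
  have hcompl : ({0}ᶜ : Set ℝ) ∈ ae volume := compl_mem_ae_iff.2 (by simp)
  have hhk : k =ᵐ[volume] h := by
    filter_upwards [hcompl] with s hs using hk s hs
  have hm : AEStronglyMeasurable k volume := by
    refine AEStronglyMeasurable.congr ?_ hhk.symm
    have := hc.aestronglyMeasurable (μ := volume) (measurableSet_singleton 0).compl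
    rwa [Measure.restrict_eq_self_of_ae_mem (s := ({0}ᶜ : Set ℝ)) hcompl] at this
  refine Integrable.congr ?_ hhk
  refine LocallyIntegrable.integrable_of_isBigO_cocompact (g := fun s : ℝ => (1 + s ^ 2)⁻¹) ?_ ?_
    (integrable_inv_one_add_sq.integrableAtFilter _)
  · intro s
    refine Measure.FiniteAtFilter.integrableAtFilter hm.stronglyMeasurableAtFilter
      (Measure.finiteAt_nhds volume s) ?_
    by_cases hs : s = 0
    · subst hs
      obtain ⟨C, hC⟩ := h0.bound
      rw [eventually_nhdsWithin_iff] at hC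
      refine ⟨max C 0, ?_⟩
      rw [eventually_map]
      filter_upwards [hC] with s hs
      by_cases hs0 : s = 0
      · subst hs0
        simp [k]
      · rw [Function.comp_apply, hk s hs0]
        exact (by simpa using hs hs0 : ‖h s‖ ≤ C).trans (le_max_left _ _)
    · have hks : ContinuousAt k s := by
        refine (hc.continuousAt (isOpen_compl_singleton.mem_nhds hs)).congr ?_
        filter_upwards [isOpen_compl_singleton.mem_nhds hs] with w hw using (hk w hw).symm
      exact hks.norm.isBoundedUnder_le
  · refine hinf.congr' ?_ EventuallyEq.rfl
    filter_upwards [(isCompact_singleton (x := (0 : ℝ))).compl_mem_cocompact] with s hs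
      using (hk s hs).symm

/-! ### Geometry of `D₊`, `D₋` and `Σ`. -/

namespace Background

variable (B : Background)

theorem neg_sign {B : Background} (hs : B.δ * B.σ = -1) : ¬ B.δ * B.σ = 1 := by
  rw [hs]
  norm_num

theorem isOpen_Dplus : IsOpen B.Dplus := by
  unfold Dplus
  split_ifs
  · exact isOpen_lt continuous_const Complex.continuous_im
  · exact isOpen_lt continuous_const (by fun_prop)

theorem isOpen_Dminus : IsOpen B.Dminus := by
  unfold Dminus
  split_ifs
  · exact isOpen_lt Complex.continuous_im continuous_const
  · exact isOpen_lt (by fun_prop) continuous_const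

theorem im_ne_zero_of_mem_Dplus {z : ℂ} (hz : z ∈ B.Dplus) : z.im ≠ 0 := by
  rcases B.sign_mul with hs | hs
  · simp only [Dplus, if_pos hs, Set.mem_ofPred_eq] at hz
    exact hz.ne'
  · simp only [Dplus, if_neg (neg_sign hs), Set.mem_ofPred_eq] at hz
    exact right_ne_zero_of_mul hz.ne'

theorem im_ne_zero_of_mem_Dminus {z : ℂ} (hz : z ∈ B.Dminus) : z.im ≠ 0 := by
  rcases B.sign_mul with hs | hs
  · simp only [Dminus, if_pos hs, Set.mem_ofPred_eq] at hz
    exact hz.ne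
  · simp only [Dminus, if_neg (neg_sign hs), Set.mem_ofPred_eq] at hz
    exact right_ne_zero_of_mul hz.ne

theorem zero_notMem_Sigma : (0 : ℂ) ∉ B.Sigma := by
  rcases B.sign_mul with hs | hs
  · simp [Sigma, if_pos hs]
  · simp [Sigma, if_neg (neg_sign hs), B.q₀_pos.ne]

theorem zero_notMem_Dplus_union : (0 : ℂ) ∉ B.Dplus ∪ B.Sigma := by
  rintro (h | h)
  exacts [B.im_ne_zero_of_mem_Dplus h rfl, B.zero_notMem_Sigma h]

theorem zero_notMem_Dminus_union : (0 : ℂ) ∉ B.Dminus ∪ B.Sigma := by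
  rintro (h | h)
  exacts [B.im_ne_zero_of_mem_Dminus h rfl, B.zero_notMem_Sigma h]

theorem notMem_Sigma_of_mem_Dplus {z : ℂ} (hz : z ∈ B.Dplus) : z ∉ B.Sigma := by
  have him := B.im_ne_zero_of_mem_Dplus hz
  rcases B.sign_mul with hs | hs
  · simp [Sigma, if_pos hs, him]
  · simp only [Dplus, if_neg (neg_sign hs), Set.mem_ofPred_eq] at hz
    have h := sub_ne_zero.1 (left_ne_zero_of_mul hz.ne')
    simp [Sigma, if_neg (neg_sign hs), him, h]

theorem notMem_Sigma_of_mem_Dminus {z : ℂ} (hz : z ∈ B.Dminus) : z ∉ B.Sigma := by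
  have him := B.im_ne_zero_of_mem_Dminus hz
  rcases B.sign_mul with hs | hs
  · simp [Sigma, if_pos hs, him]
  · simp only [Dminus, if_neg (neg_sign hs), Set.mem_ofPred_eq] at hz
    have h := sub_ne_zero.1 (left_ne_zero_of_mul hz.ne)
    simp [Sigma, if_neg (neg_sign hs), him, h]

theorem notMem_Dminus_of_mem_Dplus {z : ℂ} (hz : z ∈ B.Dplus) : z ∉ B.Dminus := by
  rcases B.sign_mul with hs | hs
  · simp only [Dplus, Dminus, if_pos hs, Set.mem_ofPred_eq] at hz ⊢
    exact hz.le.not_gt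
  · simp only [Dplus, Dminus, if_neg (neg_sign hs), Set.mem_ofPred_eq] at hz ⊢
    exact hz.le.not_gt

theorem ofReal_mem_Sigma {s : ℝ} (hs : s ≠ 0) : (s : ℂ) ∈ B.Sigma := by
  unfold Sigma
  split_ifs
  · simpa using hs
  · exact Or.inl (by simpa using hs)

theorem circleMap_mem_Sigma (hs : B.δ * B.σ = -1) (φ : ℝ) : circleMap 0 B.q₀ φ ∈ B.Sigma := by
  simp only [Sigma, if_neg (neg_sign hs)]
  exact Or.inr (norm_circleMap_zero_of_pos B.q₀_pos φ)

theorem neg_conj_mem_Dplus {z : ℂ} (hz : z ∈ B.Dplus) : -(starRingEnd ℂ) z ∈ B.Dplus := by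
  unfold Dplus at hz ⊢
  split_ifs at hz ⊢ <;> simpa using hz

/-- For `δσ = 1` the map `z ↦ q₀²/z` reverses the sign of the imaginary part. For `δσ = -1` the map
`z ↦ -q₀²/z` keeps that sign but exchanges the inside and outside of the circle. -/
theorem reflect_mem_Dminus {z : ℂ} (hz : z ∈ B.Dplus) :
    (B.δ * B.σ * B.q₀ ^ 2 / z : ℂ) ∈ B.Dminus := by
  have him := B.im_ne_zero_of_mem_Dplus hz
  have hz0 : z ≠ 0 := by
    rintro rfl
    exact him rfl
  have hn : 0 < ‖z‖ := norm_pos_iff.2 hz0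
  have hq := B.q₀_pos
  have hcast : (B.δ * B.σ * B.q₀ ^ 2 / z : ℂ) = ((B.δ * B.σ * B.q₀ ^ 2 : ℝ) : ℂ) / z := by
    push_cast
    rfl
  have him' : ∀ r : ℝ, ((r : ℂ) / z).im = -(r * z.im) / ‖z‖ ^ 2 := by
    intro r
    rw [Complex.div_im, ← Complex.normSq_eq_norm_sq]
    simp
    ring
  rw [hcast]
  rcases B.sign_mul with hs | hs
  · simp only [Dplus, Dminus, if_pos hs, Set.mem_ofPred_eq] at hz ⊢
    rw [him', hs, neg_div]
    exact neg_neg_of_pos (by positivity)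
  · simp only [Dplus, Dminus, if_neg (neg_sign hs), Set.mem_ofPred_eq] at hz ⊢
    rw [him', norm_div, hs, Complex.norm_real, Real.norm_eq_abs, neg_one_mul, abs_neg,
      abs_of_pos (by positivity)]
    have : (B.q₀ ^ 2 / ‖z‖ - B.q₀) * (-(-B.q₀ ^ 2 * z.im) / ‖z‖ ^ 2)
        = -(B.q₀ ^ 3 / ‖z‖ ^ 3 * ((‖z‖ - B.q₀) * z.im)) := by
      field_simp
      ring
    rw [this]
    exact neg_neg_of_pos (by positivity)

end Background

/-! ### The points of the discrete spectrum are distinct and avoid `Σ` and `0`. -/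

namespace DiscreteData

variable {B : Background} (S : DiscreteData B)

theorem η_mem_Dplus (n : S.Index) : S.η n ∈ B.Dplus := by
  rcases n with (n | n) | n
  exacts [S.z_mem n, B.neg_conj_mem_Dplus (S.z_mem n), S.w_mem n]

theorem η_ne_zero (n : S.Index) : S.η n ≠ 0 := fun h =>
  B.im_ne_zero_of_mem_Dplus (S.η_mem_Dplus n) (by rw [h]; rfl)

theorem ηhat_mem_Dminus (n : S.Index) : S.ηhat n ∈ B.Dminus :=
  B.reflect_mem_Dminus (S.η_mem_Dplus n)

/-- The three families are separated by the sign of the real part: positive, negative, zero. -/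
theorem η_injective : Function.Injective S.η := by
  have h1 : ∀ n, 0 < (S.η (Sum.inl (Sum.inl n))).re := fun n => S.z_re_pos n
  have h2 : ∀ n, (S.η (Sum.inl (Sum.inr n))).re < 0 := fun n => by
    simpa [η] using S.z_re_pos n
  have h3 : ∀ n, (S.η (Sum.inr n)).re = 0 := fun n => by simp [η]
  rintro ((n | n) | n) ((m | m) | m) h
  · rw [S.z_injective h]
  · linarith [h1 n, h2 m, congrArg Complex.re h]
  · linarith [h1 n, h3 m, congrArg Complex.re h]
  · linarith [h2 n, h1 m, congrArg Complex.re h]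
  · have h' : S.z n = S.z m := (starRingEnd ℂ).injective (by simpa [η] using h)
    rw [S.z_injective h']
  · linarith [h2 n, h3 m, congrArg Complex.re h]
  · linarith [h3 n, h1 m, congrArg Complex.re h]
  · linarith [h3 n, h2 m, congrArg Complex.re h]
  · have h' : S.w n = S.w m := by simpa [η] using h
    rw [S.w_injective h']

theorem ηhat_injective : Function.Injective S.ηhat := by
  intro n m h
  have hc : (B.δ * B.σ * B.q₀ ^ 2 : ℂ) ≠ 0 := by
    have : B.δ * B.σ * B.q₀ ^ 2 ≠ 0 := by
      refine mul_ne_zero ?_ (pow_ne_zero _ B.q₀_pos.ne')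
      rcases B.sign_mul with hs | hs <;> rw [hs] <;> norm_num
    exact_mod_cast this
  refine S.η_injective ?_
  unfold ηhat at h
  rw [div_eq_div_iff (S.η_ne_zero n) (S.η_ne_zero m)] at h
  exact (mul_left_cancel₀ hc h).symm

/-- All points of the discrete spectrum. -/
def points : S.Index ⊕ S.Index → ℂ := Sum.elim S.η S.ηhat

theorem range_points : Set.range S.points = S.Z := Set.Sum.elim_range _ _

theorem points_injective : Function.Injective S.points :=
  S.η_injective.sumElim S.ηhat_injective fun n m h =>
    B.notMem_Dminus_of_mem_Dplus (S.η_mem_Dplus n) (h ▸ S.ηhat_mem_Dminus m)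

theorem points_notMem_Sigma (k : S.Index ⊕ S.Index) : S.points k ∉ B.Sigma := by
  rcases k with n | n
  exacts [B.notMem_Sigma_of_mem_Dplus (S.η_mem_Dplus n),
    B.notMem_Sigma_of_mem_Dminus (S.ηhat_mem_Dminus n)]

theorem points_ne_zero (k : S.Index ⊕ S.Index) : S.points k ≠ 0 := by
  rcases k with n | n
  exacts [S.η_ne_zero n, fun h =>
    B.im_ne_zero_of_mem_Dminus (S.ηhat_mem_Dminus n) (by
      change (S.points (Sum.inr n)).im = 0
      rw [h]; rfl)]

end DiscreteData

/-! ### From the Riemann–Hilbert data to scalar functions. -/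

/-- `simpleResidue` is a limit of matrices, so the limits of all four entries are needed before a
single entry can be read off. -/
theorem HasAtMostSimplePole.exists_decomposition {f : ℂ → Mat} {z₀ : ℂ}
    (h : HasAtMostSimplePole f z₀) (i j : Fin 2) :
    ∃ g : ℂ → ℂ, AnalyticAt ℂ g z₀ ∧
      (fun z => f z i j) =ᶠ[𝓝[≠] z₀] fun z => simpleResidue f z₀ i j / (z - z₀) + g z := by
  choose r g hg hfg hr using fun i j => exists_residue_decomposition (h i j).1 (h i j).2
  have hlim : Tendsto (fun z => (z - z₀) • f z) (𝓝[≠] z₀) (𝓝 (Matrix.of r)) :=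
    tendsto_pi_nhds.2 fun i => tendsto_pi_nhds.2 fun j => hr i j
  refine ⟨g i j, hg i j, ?_⟩
  rw [simpleResidue, hlim.limUnder_eq]
  exact hfg i j

theorem contourIntegral_congr (B : Background) {g h : ℂ → ℂ} (hgh : ∀ ζ ∈ B.Sigma, g ζ = h ζ) :
    contourIntegral B g = contourIntegral B h := by
  have hae : ∀ᵐ s : ℝ, g s = h s := by
    have hcompl : ({0}ᶜ : Set ℝ) ∈ ae volume := compl_mem_ae_iff.2 (by simp)
    filter_upwards [hcompl] with s hs using hgh _ (B.ofReal_mem_Sigma hs)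
  rcases B.sign_mul with hs | hs
  · rw [contourIntegral, contourIntegral, if_pos hs, if_pos hs]
    exact integral_congr_ae hae
  · rw [contourIntegral, contourIntegral, if_neg (Background.neg_sign hs),
      if_neg (Background.neg_sign hs), integral_congr_ae (ae_restrict_of_ae hae),
      intervalIntegral.integral_congr_ae (hae.mono fun s hs _ => hs)]
    simp only [hgh _ (B.circleMap_mem_Sigma hs _)]

/-- The polar part `M₀` in terms of the points of the discrete spectrum. -/
theorem M₀_apply (B : Background) (S : DiscreteData B) (Mp Mm : ℂ → Mat) (z : ℂ) (i j : Fin 2) :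
    M₀ B S Mp Mm z i j = polarSum ((1 : Mat) i j) (Complex.I * (σ₃ * B.Qm) i j)
      (Sum.elim (fun n => simpleResidue Mp (S.η n) i j)
        fun n => simpleResidue Mm (S.ηhat n) i j) S.points z := by
  simp only [M₀, polarSum, Matrix.add_apply, Matrix.smul_apply, Matrix.sum_apply, smul_eq_mul,
    Fintype.sum_sum_type, Finset.sum_add_distrib, DiscreteData.points, Sum.elim_inl, Sum.elim_inr]
  simp only [div_eq_mul_inv, one_mul, mul_comm, mul_left_comm, mul_assoc]

section Asymptotics

variable {A : Set ℂ} {f : ℂ → ℂ} {d r : ℂ}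

theorem tendsto_mul_of_isBigO_one
    (h : (fun z => f z - Complex.I / z * r) =O[𝓝[A] 0] fun _ => (1 : ℂ)) :
    Tendsto (fun z => z * f z) (𝓝[≠] 0 ⊓ 𝓟 A) (𝓝 (Complex.I * r)) := by
  have hle : 𝓝[≠] (0 : ℂ) ⊓ 𝓟 A ≤ 𝓝[A] 0 := inf_le_inf_right _ nhdsWithin_le_nhds
  have hid : Tendsto (fun z : ℂ => z * 1) (𝓝[≠] 0 ⊓ 𝓟 A) (𝓝 0) := by
    simp only [mul_one]
    exact inf_le_left.trans nhdsWithin_le_nhds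
  have h1 := (((isBigO_refl (fun z : ℂ => z) _).mul (h.mono hle)).trans_tendsto hid).add_const
    (Complex.I * r)
  rw [zero_add] at h1
  refine h1.congr' ?_
  filter_upwards [inf_le_left (b := 𝓟 A) (self_mem_nhdsWithin (a := (0 : ℂ)) (s := {0}ᶜ))]
    with z hz
  have hz' : z ≠ 0 := hz
  field_simp
  ring

theorem tendsto_of_isBigO_one_div
    (h : (fun z => f z - d) =O[cocompact ℂ ⊓ 𝓟 A] fun z => 1 / z) :
    Tendsto f (cocompact ℂ ⊓ 𝓟 A) (𝓝 d) := by
  have h0 := tendsto_div_sub_cocompact 1 0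
  simp only [sub_zero] at h0
  simpa using (h.trans_tendsto (h0.mono_left inf_le_left)).add_const d

end Asymptotics

/-- In `f - g` the common pole cancels at `0`, leaving a bounded function, and the common constant
`d` cancels at infinity, leaving `O(1/s)`; the Cauchy kernel supplies a second factor `1/s`. -/
theorem integrable_jump_quotient {f g : ℂ → ℂ} {A A' : Set ℂ} {z d r : ℂ} (hz : z ≠ 0)
    (hA : ∀ s : ℝ, s ≠ 0 → (s : ℂ) ∈ A) (hA' : ∀ s : ℝ, s ≠ 0 → (s : ℂ) ∈ A')
    (hzs : ∀ s : ℝ, s ≠ 0 → (s : ℂ) ≠ z)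
    (hf : ContinuousOn (fun s : ℝ => f s) {0}ᶜ) (hg : ContinuousOn (fun s : ℝ => g s) {0}ᶜ)
    (hf0 : (fun z => f z - Complex.I / z * r) =O[𝓝[A] 0] fun _ => (1 : ℂ))
    (hg0 : (fun z => g z - Complex.I / z * r) =O[𝓝[A'] 0] fun _ => (1 : ℂ))
    (hfi : (fun z => f z - d) =O[cocompact ℂ ⊓ 𝓟 A] fun z => 1 / z)
    (hgi : (fun z => g z - d) =O[cocompact ℂ ⊓ 𝓟 A'] fun z => 1 / z) :
    Integrable fun s : ℝ => (f s - g s) / (s - z) := by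
  have hne : ∀ A : Set ℂ, (∀ s : ℝ, s ≠ 0 → (s : ℂ) ∈ A) →
      Tendsto (fun s : ℝ => (s : ℂ)) (𝓝[≠] 0) (𝓝[A] 0) := by
    intro A hA
    refine tendsto_nhdsWithin_iff.2 ⟨?_, ?_⟩
    · simpa using (Complex.continuous_ofReal.tendsto 0).mono_left
        (nhdsWithin_le_nhds (s := {0}ᶜ))
    · filter_upwards [self_mem_nhdsWithin] with s hs using hA s hs
  have hco : ∀ A : Set ℂ, (∀ s : ℝ, s ≠ 0 → (s : ℂ) ∈ A) →
      Tendsto (fun s : ℝ => (s : ℂ)) (cocompact ℝ) (cocompact ℂ ⊓ 𝓟 A) := by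
    intro A hA
    refine tendsto_inf.2 ⟨Complex.isometry_ofReal.isClosedEmbedding.tendsto_cocompact,
      tendsto_principal.2 ?_⟩
    filter_upwards [(isCompact_singleton (x := (0 : ℝ))).compl_mem_cocompact] with s hs
      using hA s hs
  refine integrable_of_continuousOn_isBigO ?_ ?_ ?_
  · exact (hf.sub hg).div (by fun_prop) fun s hs => sub_ne_zero.2 (hzs s hs)
  · have h1 : (fun s : ℝ => f s - g s) =O[𝓝[≠] 0] fun _ => (1 : ℂ) := by
      refine ((hf0.comp_tendsto (hne A hA)).sub (hg0.comp_tendsto (hne A' hA'))).congr_left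
        fun s => ?_
      simp
    have h2 : (fun s : ℝ => ((s : ℂ) - z)⁻¹) =O[𝓝[≠] 0] fun _ => (1 : ℝ) := by
      have : ContinuousAt (fun s : ℝ => ((s : ℂ) - z)⁻¹) 0 :=
        ContinuousAt.inv₀ (by fun_prop) (by simpa using hz)
      exact (this.tendsto.mono_left nhdsWithin_le_nhds).isBigO_one ℝ
    have h3 := (h1.trans (isBigO_const_const (1 : ℂ) (one_ne_zero (α := ℝ)) _)).mul h2
    simpa [div_eq_mul_inv] using h3
  · have h1 : (fun s : ℝ => f s - g s) =O[cocompact ℝ] fun s : ℝ => 1 / (s : ℂ) := by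
      refine ((hfi.comp_tendsto (hco A hA)).sub (hgi.comp_tendsto (hco A' hA'))).congr_left
        fun s => ?_
      simp
    have h2 : (fun s : ℝ => 1 + z / ((s : ℂ) - z)) =O[cocompact ℝ] fun _ => (1 : ℂ) :=
      (((tendsto_div_sub_cocompact z z).comp
        Complex.isometry_ofReal.isClosedEmbedding.tendsto_cocompact).const_add 1).isBigO_one ℂ
    have h3 := (h1.mul h2).mul (isBigO_refl (fun s : ℝ => 1 / (s : ℂ)) (cocompact ℝ))
    -- The constant `2` comes from `1 + s² ≤ 2 s²` for `|s| > 1`.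
    refine IsBigO.trans (IsBigO.congr' h3 ?_ EventuallyEq.rfl) (IsBigO.of_bound 2 ?_)
    · filter_upwards [(isCompact_singleton (x := (0 : ℝ))).compl_mem_cocompact] with s hs
      have hs' : (s : ℂ) ≠ 0 := by simpa using hs
      have hsz : (s : ℂ) - z ≠ 0 := sub_ne_zero.2 (hzs s hs)
      field_simp
      ring
    · filter_upwards [(isCompact_closedBall (0 : ℝ) 1).compl_mem_cocompact] with s hs
      have hs1 : 1 < |s| := by simpa using hs
      have hs2 : 1 < s ^ 2 := by
        rw [← sq_abs]
        nlinarith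
      have : ‖(1 / (s : ℂ)) * 1 * (1 / (s : ℂ))‖ = 1 / s ^ 2 := by
        rw [mul_one, norm_mul, norm_div, norm_one, Complex.norm_real, Real.norm_eq_abs, ← sq_abs]
        field_simp
      rw [this, Real.norm_eq_abs, abs_of_pos (by positivity), ← div_eq_mul_inv,
        div_le_div_iff₀ (by positivity) (by positivity)]
      linarith

theorem IsRHPSolution.entry {B : Background} {S : DiscreteData B} {ρ ρt : ℂ → ℂ} {x t : ℝ}
    {Mp Mm : ℂ → Mat} (hM : IsRHPSolution B S ρ ρt x t Mp Mm) {z : ℂ} (hz_cont : z ∉ B.Sigma)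
    (hz_ne : z ≠ 0) (hz_disc : z ∉ S.Z) (i j : Fin 2) :
    ContourIntegrable B (fun ζ => (Mp ζ * jump B ρ ρt x t ζ) i j / (ζ - z)) ∧
    contourIntegral B (fun ζ => (Mp ζ * jump B ρ ρt x t ζ) i j / (ζ - z))
      = 2 * Real.pi * Complex.I * (sectional B Mp Mm z i j - M₀ B S Mp Mm z i j) := by
  have hjump : ∀ ζ ∈ B.Sigma, (Mp ζ * jump B ρ ρt x t ζ) i j / (ζ - z)
      = (Mp ζ i j - Mm ζ i j) / (ζ - z) := by
    intro ζ hζ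
    rw [hM.jump_relation ζ hζ, mul_sub, mul_one, Matrix.sub_apply, sub_sub_cancel]
  have hcp : ContinuousOn (fun ζ => Mp ζ i j) ((B.Dplus ∪ B.Sigma) \ S.Z) :=
    (continuous_apply_apply (ρ := fun _ _ => ℂ) i j).comp_continuousOn hM.continuous_plus
  have hcm : ContinuousOn (fun ζ => Mm ζ i j) ((B.Dminus ∪ B.Sigma) \ S.Z) :=
    (continuous_apply_apply (ρ := fun _ _ => ℂ) i j).comp_continuousOn hM.continuous_minus
  have hSZ : ∀ ζ ∈ B.Sigma, ζ ∉ S.Z := by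
    rintro ζ hζ h
    rw [← S.range_points] at h
    obtain ⟨k, rfl⟩ := h
    exact S.points_notMem_Sigma k hζ
  have hcpS : ContinuousOn (fun ζ => Mp ζ i j) B.Sigma :=
    hcp.mono fun ζ h => ⟨Or.inr h, hSZ ζ h⟩
  have hcmS : ContinuousOn (fun ζ => Mm ζ i j) B.Sigma :=
    hcm.mono fun ζ h => ⟨Or.inr h, hSZ ζ h⟩
  have hreal : Set.MapsTo (fun s : ℝ => (s : ℂ)) {0}ᶜ B.Sigma := fun s hs => B.ofReal_mem_Sigma hs
  have hip : (fun ζ => Mp ζ i j - (1 : Mat) i j) =O[cocompact ℂ ⊓ 𝓟 (B.Dplus ∪ B.Sigma)]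
      fun ζ => 1 / ζ := hM.infty_plus i j
  have him : (fun ζ => Mm ζ i j - (1 : Mat) i j) =O[cocompact ℂ ⊓ 𝓟 (B.Dminus ∪ B.Sigma)]
      fun ζ => 1 / ζ := hM.infty_minus i j
  have h0p : (fun ζ => Mp ζ i j - Complex.I / ζ * (σ₃ * B.Qm) i j)
      =O[𝓝[B.Dplus ∪ B.Sigma] 0] fun _ => (1 : ℂ) := hM.zero_plus i j
  have h0m : (fun ζ => Mm ζ i j - Complex.I / ζ * (σ₃ * B.Qm) i j)
      =O[𝓝[B.Dminus ∪ B.Sigma] 0] fun _ => (1 : ℂ) := hM.zero_minus i j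
  have hint : Integrable fun s : ℝ => (Mp s i j - Mm s i j) / (s - z) :=
    integrable_jump_quotient (f := fun ζ => Mp ζ i j) (g := fun ζ => Mm ζ i j) hz_ne
      (fun s hs => Or.inr (B.ofReal_mem_Sigma hs)) (fun s hs => Or.inr (B.ofReal_mem_Sigma hs))
      (fun s hs h => hz_cont (h ▸ B.ofReal_mem_Sigma hs))
      (hcpS.comp Complex.continuous_ofReal.continuousOn hreal)
      (hcmS.comp Complex.continuous_ofReal.continuousOn hreal) h0p h0m hip him
  have hcompl : ({0}ᶜ : Set ℝ) ∈ ae volume := compl_mem_ae_iff.2 (by simp)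
  refine ⟨⟨hint.congr ?_, fun hs => ?_⟩, ?_⟩
  · filter_upwards [hcompl] with s hs using (hjump _ (B.ofReal_mem_Sigma hs)).symm
  · refine ContinuousOn.circleIntegrable B.q₀_pos.le ?_
    have hsub : Metric.sphere (0 : ℂ) B.q₀ ⊆ B.Sigma := by
      intro ζ hζ
      simp only [Background.Sigma, if_neg (Background.neg_sign hs)]
      exact Or.inr (mem_sphere_zero_iff_norm.1 hζ)
    refine ContinuousOn.congr (f := fun ζ => (Mp ζ i j - Mm ζ i j) / (ζ - z)) ?_
      fun ζ hζ => hjump ζ (hsub hζ)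
    exact ((hcpS.mono hsub).sub (hcmS.mono hsub)).div (by fun_prop) fun ζ hζ =>
      sub_ne_zero.2 fun h => hz_cont (h ▸ hsub hζ)
  · set c := sectional B Mp Mm z i j - M₀ B S Mp Mm z i j with hc
    rw [M₀_apply] at hc
    rw [← S.range_points] at hz_disc
    obtain ⟨Fp, hFp1, hFp2, hFp3, hFp4, hFp5⟩ := exists_cauchyQuotient (c := c)
      (a := Sum.elim (fun n => simpleResidue Mp (S.η n) i j)
        fun n => simpleResidue Mm (S.ηhat n) i j) (f := fun ζ => Mp ζ i j)
      S.points_injective S.points_ne_zero S.points_notMem_Sigma hz_ne hz_cont hz_disc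
      B.isOpen_Dplus B.zero_notMem_Dplus_union
      (fun ζ hζ hζZ => hM.analytic_plus i j ζ ⟨hζ, S.range_points ▸ hζZ⟩)
      (by rwa [S.range_points])
      (by
        -- Only the points `η` lie in `D₊`, so the residues of `M⁻` in the common polar sum impose
        -- nothing on this side.
        rintro (n | n) hn
        · exact (hM.pole_plus _ ⟨Or.inl ⟨n, rfl⟩, hn⟩).exists_decomposition i j
        · exact absurd (S.ηhat_mem_Dminus n) (B.notMem_Dminus_of_mem_Dplus hn))
      (fun hz => by rw [hc, sectional, if_pos hz])
      (tendsto_mul_of_isBigO_one h0p) (tendsto_of_isBigO_one_div hip)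
    obtain ⟨Fm, hFm1, hFm2, hFm3, hFm4, hFm5⟩ := exists_cauchyQuotient (c := c)
      (a := Sum.elim (fun n => simpleResidue Mp (S.η n) i j)
        fun n => simpleResidue Mm (S.ηhat n) i j) (f := fun ζ => Mm ζ i j)
      S.points_injective S.points_ne_zero S.points_notMem_Sigma hz_ne hz_cont hz_disc
      B.isOpen_Dminus B.zero_notMem_Dminus_union
      (fun ζ hζ hζZ => hM.analytic_minus i j ζ ⟨hζ, S.range_points ▸ hζZ⟩)
      (by rwa [S.range_points])
      (by
        rintro (n | n) hn
        · exact absurd hn (B.notMem_Dminus_of_mem_Dplus (S.η_mem_Dplus n))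
        · exact (hM.pole_minus _ ⟨Or.inr ⟨n, rfl⟩, hn⟩).exists_decomposition i j)
      (fun hz => by
        rw [hc, sectional, if_neg fun h => B.notMem_Dminus_of_mem_Dplus h hz])
      (tendsto_mul_of_isBigO_one h0m) (tendsto_of_isBigO_one_div him)
    -- The polar sum and `c` are the same on both sides and cancel in the difference.
    have hF : ∀ ζ ∈ B.Sigma, (Mp ζ i j - Mm ζ i j) / (ζ - z) = Fp ζ - Fm ζ := by
      intro ζ hζ
      rw [hFp3 ζ hζ, hFm3 ζ hζ]
      ring
    rw [contourIntegral_congr B fun ζ hζ => (hjump ζ hζ).trans (hF ζ hζ),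
      contourIntegral_sub_eq B hFp1 hFm1 hFp2 hFm2 hFp4 hFm4 hFp5 hFm5 (hint.congr (by
        filter_upwards [hcompl] with s hs using hF _ (B.ofReal_mem_Sigma hs)))]
    ring

end NonlocalMKdV

end

theorem mainTheorem2 (B : NonlocalMKdV.Background) (S : NonlocalMKdV.DiscreteData B)
    (ρ ρt : ℂ → ℂ) (x t : ℝ) (Mp Mm : ℂ → NonlocalMKdV.Mat)
    (hM : NonlocalMKdV.IsRHPSolution B S ρ ρt x t Mp Mm)
    (z : ℂ) (hz_cont : z ∉ B.Sigma) (hz_ne : z ≠ 0) (hz_disc : z ∉ S.Z) :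
    (∀ i j, NonlocalMKdV.ContourIntegrable B
      (fun ζ => (Mp ζ * NonlocalMKdV.jump B ρ ρt x t ζ) i j / (ζ - z))) ∧
    NonlocalMKdV.sectional B Mp Mm z =
      NonlocalMKdV.M₀ B S Mp Mm z +
        (1 / (2 * (Real.pi : ℂ) * Complex.I)) • Matrix.of fun i j =>
          NonlocalMKdV.contourIntegral B
            (fun ζ => (Mp ζ * NonlocalMKdV.jump B ρ ρt x t ζ) i j / (ζ - z)) := by
  refine ⟨fun i j => (hM.entry hz_cont hz_ne hz_disc i j).1, ?_⟩
  ext i j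
  rw [Matrix.add_apply, Matrix.smul_apply, Matrix.of_apply,
    (hM.entry hz_cont hz_ne hz_disc i j).2, smul_eq_mul, one_div,
    inv_mul_cancel_left₀ Complex.two_pi_I_ne_zero, add_sub_cancel]
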